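/- Let $N\ge 2$ be an integer, let $\mathbb T$ be the unit circle with normalized Haar measure $\mu$, and write $R f(z)=\frac1N\sum_{w^N=z}|m_0(w)|^2f(w)$ for the transfer operator of a filter $m_0\in L^\infty(\mathbb T)$. Suppose that $m_0$ is non-singular, i.e. $\{z: m_0(z)=0\}$ has measure zero and $|m_0|$ is not a.e. equal to the constant $1$, and that $R1=1$ a.e. Let $m_1,\dots,m_{N-1}\in L^\infty(\mathbb T)$ be such that, with $\rho=e^{2\pi i/N}$, the matrix $\frac1{\sqrt N}\bigl(m_i(\rho^jz)\bigr)_{0\le i,j\le N-1}$ is unitary for a.e. $z\in\mathbb T$. For an integrable $g\ge0$ on $\mathbb T$ with $R g=g$ a.e., a cyclic representation associated to $g$ is a tuple $(U_g,\pi_g,H_g,\varphi_g)$ where $H_g$ is a complex Hilbert space, $U_g$ is a unitary operator on $H_g$, $\pi_g$ is a (unital $*$-) representation of $L^\infty(\mathbb T)$ on $H_g$, and $\varphi_g\in H_g$, such that $\overline{\operatorname{span}}\{U_g^{-n}\pi_g(f)\varphi_g: n\in\mathbb N, f\in L^\infty(\mathbb T)\}=H_g$, $U_g\pi_g(f)U_g^{-1}=\pi_g(f(z^N))$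 for all $f\in L^\infty(\mathbb T)$, $U_g\varphi_g=\pi_g(m_0)\varphi_g$, and $\langle \pi_g(f)\varphi_g,\varphi_g\rangle=\int_{\mathbb T} f g\,d\mu$ for all $f\in L^\infty(\mathbb T)$ (it exists and is unique up to unitary equivalence). Put $T_g=\pi_g(z)$ and $\psi_i^g=U_g^{-1}\pi_g(m_i)\varphi_g$ for $1\le i\le N-1$. Let $h\in L^\infty(\mathbb T)$, $h\ge0$, $R h=h$, let $(U_h,\pi_h,H_h,\varphi_h)$ be a cyclic representation associated to $h$, and let $(U_1,\pi_1,H_1,\varphi_1)$ be a cyclic representation associated to the constant function $1$. Suppose that the family $\{U_h^mT_h^n\psi_i^h: m,n\in\mathbb Z,\ 1\le i\le N-1\}$ is a normalized tight frame for $H_h$, i.e. $\sum_{m,n,i}|\langle v,U_h^mT_h^n\psi_i^h\rangle|^2=\|v\|^2$ for all $v\in H_h$. Then there is a linear isometry $W:H_h\to H_1$ with the following properties, where $P$ denotes the orthogonal projection of $H_1$ onto $WH_h$: 1. $WU_h=U_1W$, and $W\pi_h(f)=\pi_1(f)W$ for all $f\in L^\infty(\mathbb T)$. 2. $PU_1=U_1P$,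 $P\pi_1(f)=\pi_1(f)P$ for all $f\in L^\infty(\mathbb T)$, and $P\varphi_1=W\varphi_h$. 3. $\{U_1^mT_1^n\psi_i^1: m,n\in\mathbb Z,\ 1\le i\le N-1\}$ is an orthonormal basis for $H_1$, and $P\psi_i^1=W\psi_i^h$ for $1\le i\le N-1$. -/

import Mathlib

open MeasureTheory
open scoped ENNReal InnerProductSpace

noncomputable section

namespace WaveletDilation

/-- The circle group `𝕋`, written additively as `ℝ / ℤ`: the point `x` stands for
`z = exp (2 π i x)`, so that `z ^ N` is `N • x`. -/
abbrev Torus : Type := UnitAddCircle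

/-- The normalized Haar measure of the circle. -/
abbrev haar : Measure Torus := AddCircle.haarAddCircle

/-- The star algebra of the (representatives of) functions in `L^∞(𝕋)`. Everything below depends
only on the almost everywhere classes of its elements. -/
def Linf : StarSubalgebra ℂ (Torus → ℂ) where
  carrier := {f | MemLp f ∞ haar}
  mul_mem' hf hg := MemLp.mul' (p := ∞) (q := ∞) (r := ∞) hg hf
  one_mem' := memLp_const (1 : ℂ)
  add_mem' hf hg := MemLp.add hf hg
  zero_mem' := MemLp.zero
  algebraMap_mem' c := memLp_const c
  star_mem' hf := MemLp.star hf

/-- Multiplication by `N` on the circle (that is `z ↦ z ^ N`) preserves the Haar measure. -/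
theorem measurePreserving_nsmul (N : ℕ) [N.AtLeastTwo] :
    MeasurePreserving (fun x : Torus => N • x) haar haar := by
  have h := Measure.measurePreserving_zsmul (G := Torus) haar (n := (N : ℤ))
    (by exact_mod_cast NeZero.ne N)
  simpa using h

/-- The function `z ↦ f (z ^ N)`. -/
def dilate (N : ℕ) [N.AtLeastTwo] (f : Linf) : Linf :=
  ⟨fun x => f.1 (N • x), f.2.comp_measurePreserving (measurePreserving_nsmul N)⟩

/-- The coordinate function `z`, as a unitary element of `L^∞(𝕋)`. -/
def coord : unitary Linf :=
  ⟨⟨fun x => fourier 1 x, by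
      refine memLp_top_of_bound (ContinuousMap.continuous _).aestronglyMeasurable 1 ?_
      exact Filter.Eventually.of_forall fun x => (Circle.norm_coe _).le⟩, by
    constructor <;>
    · ext x
      simp [← Circle.coe_inv_eq_conj]⟩

/-- The transfer operator
`(R_{m₀,m₀} f)(z) = (1 / N) ∑_{w ^ N = z} |m₀ (w)|² f (w)` on real functions. -/
def transfer (N : ℕ) (m₀ : Torus → ℂ) (f : Torus → ℝ) : Torus → ℝ :=
  fun x => (N : ℝ)⁻¹ * ∑ᶠ y ∈ {y : Torus | N • y = x}, ‖m₀ y‖ ^ 2 * f y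

/-- A filter is non-singular if its zero set is null and its modulus is not a.e. equal to `1`. -/
def NonSingular (m₀ : Torus → ℂ) : Prop :=
  (∀ᵐ x ∂haar, m₀ x ≠ 0) ∧ ¬ ∀ᵐ x ∂haar, ‖m₀ x‖ = 1

/-- The matrix `N^{-1/2} (m_i (ρ ^ j z))_{i, j}`, `ρ = exp (2 π i / N)`, is unitary for almost
every `z`. -/
def UnitaryFilters (N : ℕ) (m : Fin N → Torus → ℂ) : Prop :=
  ∀ᵐ x ∂haar,
    (Matrix.of fun i j : Fin N =>
        ((Real.sqrt N : ℝ) : ℂ)⁻¹ * m i (x + (((j : ℕ) : ℝ) / (N : ℝ) : ℝ)))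
      ∈ Matrix.unitaryGroup (Fin N) ℂ

/-- `(U, π, H, φ)` is a cyclic representation associated to the function `h`: `U` is a unitary
operator on the Hilbert space `H`, `π` a representation of `L^∞(𝕋)` on `H`, and `φ ∈ H` is such
that `span {U⁻ⁿ π(f) φ}` is dense, `U π(f) U⁻¹ = π(f(z^N))`, `U φ = π(m₀) φ` and
`⟨π(f) φ, φ⟩ = ∫ f h`. These properties determine it up to unitary equivalence; for its existence
see `CyclicRep.nonempty`. -/
structure CyclicRep (N : ℕ) [N.AtLeastTwo] (m₀ : Linf) (h : Torus → ℝ) (H : Type*)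
    [NormedAddCommGroup H] [InnerProductSpace ℂ H] [CompleteSpace H] where
  U : unitary (H →L[ℂ] H)
  π : Linf →⋆ₐ[ℂ] (H →L[ℂ] H)
  φ : H
  π_congr : ∀ f g : Linf, f.1 =ᵐ[haar] g.1 → π f = π g
  cyclic : (Submodule.span ℂ
    {v : H | ∃ (n : ℕ) (f : Linf), v = (↑(U⁻¹ ^ n) : H →L[ℂ] H) (π f φ)}).topologicalClosure = ⊤
  covariant : ∀ f : Linf, (U : H →L[ℂ] H) * π f * (↑U⁻¹ : H →L[ℂ] H) = π (dilate N f)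
  scaling : (U : H →L[ℂ] H) φ = π m₀ φ
  inner_eq : ∀ f : Linf, ⟪φ, π f φ⟫_ℂ = ∫ x, f.1 x * (h x : ℂ) ∂haar

namespace CyclicRep

variable {N : ℕ} [N.AtLeastTwo] {m₀ : Linf} {h : Torus → ℝ} {H : Type*}
  [NormedAddCommGroup H] [InnerProductSpace ℂ H] [CompleteSpace H]

/-- The unitary operator `T = π(z)`. -/
def T (r : CyclicRep N m₀ h H) : unitary (H →L[ℂ] H) :=
  ⟨r.π coord, Unitary.map_mem r.π coord.2⟩

/-- The vector `U⁻¹ π(g) φ`. -/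
def ψ (r : CyclicRep N m₀ h H) (g : Linf) : H :=
  (↑r.U⁻¹ : H →L[ℂ] H) (r.π g r.φ)

/-- The family `U^a T^b ψ_i`, `a, b ∈ ℤ`, `i = 1, …, N - 1`, where `ψ_i = U⁻¹ π(m_i) φ`. -/
def waveletSystem (r : CyclicRep N m₀ h H) (m : Fin N → Linf) :
    ℤ × ℤ × {i : Fin N // i ≠ 0} → H :=
  fun k => (↑(r.U ^ k.1 * r.T ^ k.2.1) : H →L[ℂ] H) (r.ψ (m k.2.2))

end CyclicRep

section Frames

variable {ι H H' : Type*} [NormedAddCommGroup H] [InnerProductSpace ℂ H]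
  [NormedAddCommGroup H'] [InnerProductSpace ℂ H']

/-- Normalized tight frames: `∑ |⟨v, x_i⟩|² = ‖v‖²` for all `v`. -/
def IsNormalizedTightFrame (x : ι → H) : Prop :=
  ∀ v : H, HasSum (fun i => ‖⟪v, x i⟫_ℂ‖ ^ 2) (‖v‖ ^ 2)

/-- Orthonormal bases in the Hilbert space sense: total orthonormal families. -/
def IsOrthonormalBasis (x : ι → H) : Prop :=
  Orthonormal ℂ x ∧ (Submodule.span ℂ (Set.range x)).topologicalClosure = ⊤

/-- The orthogonal projection of `H'` onto the (closed) range of an isometry `W : H → H'`. -/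
def rangeProjection [CompleteSpace H] (W : H →ₗᵢ[ℂ] H') : H' →L[ℂ] H' :=
  haveI : CompleteSpace (LinearMap.range W.toLinearMap) :=
    (W.isometry.isUniformInducing.isComplete_range).completeSpace_coe
  (LinearMap.range W.toLinearMap).starProjection

end Frames

/-! The remainder constructs a cyclic representation for every admissible `h`, which shows that the
structure `CyclicRep` is inhabited. -/

section Existence

variable {N : ℕ} [N.AtLeastTwo]

theorem transfer_nsmul (m₀ : Torus → ℂ) (k : Torus → ℝ) (x : Torus) :
    transfer N m₀ k (N • x) = (N : ℝ)⁻¹ * ∑ j : Fin N,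
      ‖m₀ (x + (((j : ℕ) : ℝ) / (N : ℝ) : ℝ))‖ ^ 2 * k (x + (((j : ℕ) : ℝ) / (N : ℝ) : ℝ)) := by
  have hN : 0 < N := NeZero.pos N
  have hN' : (0 : ℝ) < N := by exact_mod_cast hN
  let e : Fin N → Torus := fun j => x + (((j : ℕ) : ℝ) / (N : ℝ) : ℝ)
  have he : Function.Injective e := by
    intro i j hij
    have h1 : ((((i : ℕ) : ℝ) / (N : ℝ) : ℝ) : Torus) = (((j : ℕ) : ℝ) / (N : ℝ) : ℝ) :=
      add_left_cancel hij
    have hm : ∀ i : Fin N, ((i : ℕ) : ℝ) / (N : ℝ) ∈ Set.Ico (0 : ℝ) (0 + 1) := fun i =>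
      ⟨by positivity, by
        rw [zero_add, div_lt_one hN']
        exact_mod_cast i.2⟩
    have h2 := (AddCircle.coe_eq_coe_iff_of_mem_Ico (hm i) (hm j)).1 h1
    rw [div_left_inj' hN'.ne'] at h2
    exact Fin.ext (by exact_mod_cast h2)
  have hr : {y : Torus | N • y = N • x} = Set.range e := by
    ext y
    simp only [Set.mem_ofPred_eq, Set.mem_range, e]
    rw [← sub_eq_zero, ← smul_sub, AddCircle.nsmul_eq_zero_iff hN]
    constructor
    · rintro ⟨j, hj, h1⟩
      refine ⟨⟨j, hj⟩, ?_⟩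
      rw [mul_one] at h1
      rw [h1, add_sub_cancel]
    · rintro ⟨j, rfl⟩
      exact ⟨j, j.2, by simp⟩
  unfold transfer
  rw [hr, finsum_mem_range he, finsum_eq_sum_of_fintype]

/-- The data from which a cyclic representation is built. -/
structure Datum (N : ℕ) [N.AtLeastTwo] where
  m₀ : Linf
  h : Torus → ℝ
  integrable : Integrable h haar
  nonneg : 0 ≤ᵐ[haar] h
  harmonic : transfer N m₀.1 h =ᵐ[haar] h

namespace Datum

variable (D : Datum N)

/-- The integral `∫ (conj f) g h`. -/
def form (f g : Linf) : ℂ := ∫ x, star (f.1 x) * g.1 x * (D.h x : ℂ) ∂haar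

theorem integrable_form (f g : Linf) :
    Integrable (fun x => star (f.1 x) * g.1 x * (D.h x : ℂ)) haar :=
  D.integrable.ofReal.mul_of_top_right (star f * g).2

theorem form_step (f g : Linf) :
    D.form (D.m₀ * dilate N f) (D.m₀ * dilate N g) = D.form f g := by
  have hN : (N : ℂ) ≠ 0 := by exact_mod_cast NeZero.ne N
  let k : Torus → ℂ := fun x => star ((D.m₀ * dilate N f).1 x) * (D.m₀ * dilate N g).1 x * D.h x
  have hk : Integrable k haar := D.integrable_form _ _
  let a : Torus → ℂ := fun x => star (f.1 x) * g.1 x * (transfer N D.m₀.1 D.h x : ℝ)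
  have ha : a =ᵐ[haar] fun x => star (f.1 x) * g.1 x * (D.h x : ℂ) := by
    filter_upwards [D.harmonic] with x hx
    simp only [a, hx]
  have ham : AEStronglyMeasurable a haar := (D.integrable_form f g).aestronglyMeasurable.congr ha.symm
  have hak : ∀ x, a (N • x) = (N : ℂ)⁻¹ * ∑ j : Fin N, k (x + (((j : ℕ) : ℝ) / (N : ℝ) : ℝ)) := by
    intro x
    have hx : ∀ j : Fin N, N • (x + ((((j : ℕ) : ℝ) / (N : ℝ) : ℝ) : Torus)) = N • x := by
      intro j
      have h0 : N • ((((j : ℕ) : ℝ) / (N : ℝ) : ℝ) : Torus) = 0 :=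
        (AddCircle.nsmul_eq_zero_iff (NeZero.pos N)).2 ⟨j, j.2, by simp⟩
      rw [smul_add, h0, add_zero]
    simp only [a, transfer_nsmul]
    push_cast
    rw [mul_left_comm, Finset.mul_sum]
    congr 1
    refine Finset.sum_congr rfl fun j _ => ?_
    simp only [k, dilate, MulMemClass.coe_mul, Pi.mul_apply, hx, star_mul']
    have := Complex.conj_mul' (D.m₀.1 (x + ((((j : ℕ) : ℝ) / (N : ℝ) : ℝ) : Torus)))
    rw [← this]
    simp only [Complex.star_def]
    ring
  have h1 : ∫ x, a x ∂haar = ∫ x, a (N • x) ∂haar := by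
    have hmp := measurePreserving_nsmul N
    rw [← integral_map (φ := fun x : Torus => N • x) hmp.measurable.aemeasurable
      (by rwa [hmp.map_eq]), hmp.map_eq]
  have h2 : ∫ x, a (N • x) ∂haar = ∫ x, k x ∂haar := by
    simp only [hak]
    rw [integral_const_mul, integral_finsetSum]
    · simp only [integral_add_right_eq_self, Finset.sum_const, Finset.card_univ, Fintype.card_fin,
        nsmul_eq_mul]
      rw [inv_mul_cancel_left₀ hN]
    · intro j _
      exact hk.comp_add_right _
  rw [form, form, ← integral_congr_ae ha, h1, h2]

theorem form_add_left (f g k : Linf) : D.form (f + g) k = D.form f k + D.form g k := by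
  rw [form, form, form, ← integral_add (D.integrable_form _ _) (D.integrable_form _ _)]
  congr 1
  ext x
  simp [add_mul]

theorem form_smul_left (c : ℂ) (f g : Linf) : D.form (c • f) g = star c * D.form f g := by
  rw [form, form, ← integral_const_mul]
  congr 1
  ext x
  simp [mul_assoc]

theorem form_symm (f g : Linf) : star (D.form g f) = D.form f g := by
  rw [form, form, Complex.star_def, ← integral_conj]
  congr 1
  ext x
  simp only [map_mul, Complex.conj_conj, Complex.conj_ofReal]
  ring

theorem form_mul (k f g : Linf) : D.form (k * f) g = D.form f (star k * g) := by
  rw [form, form]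
  congr 1
  ext x
  simp only [star_mul', MulMemClass.coe_mul, StarMemClass.coe_star, Pi.mul_apply, Pi.star_apply,
    Complex.star_def]
  ring

theorem form_self (f : Linf) : D.form f f = (∫ x, ‖f.1 x‖ ^ 2 * D.h x ∂haar : ℝ) := by
  rw [form, ← integral_complex_ofReal]
  congr 1
  ext x
  push_cast
  rw [← Complex.conj_mul', Complex.star_def]

theorem form_self_nonneg (f : Linf) : 0 ≤ (D.form f f).re := by
  rw [form_self, Complex.ofReal_re]
  refine integral_nonneg_of_ae ?_
  filter_upwards [D.nonneg] with x hx
  exact mul_nonneg (by positivity) hx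

theorem exists_bound (f : Linf) : ∃ C : ℝ, 0 ≤ C ∧ ∀ᵐ x ∂haar, ‖f.1 x‖ ≤ C := by
  refine ⟨lpNorm f.1 ∞ haar, lpNorm_nonneg, ae_le_lpNorm_exponent_top f.2⟩

theorem form_mul_self_le (k f : Linf) (C : ℝ) (hC : ∀ᵐ x ∂haar, ‖k.1 x‖ ≤ C) :
    (D.form (k * f) (k * f)).re ≤ C ^ 2 * (D.form f f).re := by
  have hi : ∀ f : Linf, Integrable (fun x => ‖f.1 x‖ ^ 2 * D.h x) haar := by
    intro f
    have := (D.integrable_form f f).re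
    refine this.congr (Filter.Eventually.of_forall fun x => ?_)
    simp only [Complex.star_def, Complex.conj_mul']
    norm_cast
  rw [form_self, form_self, Complex.ofReal_re, Complex.ofReal_re, ← integral_const_mul]
  refine integral_mono_ae (hi _) ((hi _).const_mul _) ?_
  filter_upwards [hC, D.nonneg] with x hx h0
  simp only [MulMemClass.coe_mul, Pi.mul_apply, norm_mul, mul_pow]
  rw [← mul_assoc]
  gcongr


/-- The function `z ↦ f (z ^ (N ^ n))`. -/
def dil (N : ℕ) [N.AtLeastTwo] (n : ℕ) (f : Linf) : Linf :=
  ⟨fun x => f.1 (N ^ n • x), by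
    have := (measurePreserving_nsmul N).iterate n
    rw [smul_iterate] at this
    exact f.2.comp_measurePreserving this⟩

theorem dil_ae (n : ℕ) {p : ℂ → ℂ → Prop} {f g : Linf} (hf : ∀ᵐ x ∂haar, p (f.1 x) (g.1 x)) :
    ∀ᵐ x ∂haar, p ((dil N n f).1 x) ((dil N n g).1 x) := by
  have := (measurePreserving_nsmul N).iterate n
  rw [smul_iterate] at this
  exact this.quasiMeasurePreserving.ae (p := fun x => p (f.1 x) (g.1 x)) hf

theorem dil_zero (f : Linf) : dil N 0 f = f := by
  ext x
  simp [dil]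

theorem dilate_dil (n : ℕ) (f : Linf) : dilate N (dil N n f) = dil N (n + 1) f := by
  ext x
  simp only [dilate, dil, smul_smul, pow_succ]

theorem dil_dilate (n : ℕ) (f : Linf) : dil N n (dilate N f) = dil N (n + 1) f := by
  ext x
  simp only [dilate, dil, smul_smul, pow_succ']

theorem dilate_mul (f g : Linf) : dilate N (f * g) = dilate N f * dilate N g := rfl

/-- Sequences `s` in `L^∞` with `s (n + 1) = m₀ (z) s n (z ^ N)` for all large `n`; such a sequence
stands for the common value of `U⁻ⁿ π(s n) φ` for large `n`. -/
def space : Submodule ℂ (ℕ → Linf) where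
  carrier := {s | ∀ᶠ n in Filter.atTop, s (n + 1) = D.m₀ * dilate N (s n)}
  add_mem' {s t} hs ht := by
    filter_upwards [hs, ht] with n h1 h2
    rw [Pi.add_apply, h1, h2, ← mul_add]
    rfl
  zero_mem' := Filter.Eventually.of_forall fun n => (mul_zero D.m₀).symm
  smul_mem' c s hs := by
    filter_upwards [hs] with n h1
    rw [Pi.smul_apply, h1, ← mul_smul_comm]
    rfl

/-- The pre-Hilbert space of these sequences. -/
def Pre : Type := D.space

instance : AddCommGroup D.Pre := inferInstanceAs (AddCommGroup D.space)
instance : Module ℂ D.Pre := inferInstanceAs (Module ℂ D.space)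

theorem Pre.ext {s t : D.Pre} (h : ∀ n, s.1 n = t.1 n) : s = t := Subtype.ext (funext h)

/-- The eventual value of `∫ conj (s n) (t n) h`. -/
def ip (s t : D.Pre) : ℂ := Filter.atTop.limUnder fun n => D.form (s.1 n) (t.1 n)

theorem ip_spec (s t : D.Pre) : ∀ᶠ n in Filter.atTop, D.form (s.1 n) (t.1 n) = D.ip s t := by
  obtain ⟨M, hM⟩ := Filter.eventually_atTop.1 (s.2.and t.2)
  have hc : ∀ n ≥ M, D.form (s.1 n) (t.1 n) = D.form (s.1 M) (t.1 M) := by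
    intro n hn
    induction n, hn using Nat.le_induction with
    | base => rfl
    | succ n hn ih => rw [← ih, (hM n hn).1, (hM n hn).2, form_step]
  have he : D.ip s t = D.form (s.1 M) (t.1 M) :=
    (tendsto_atTop_of_eventually_const hc).limUnder_eq
  exact Filter.eventually_atTop.2 ⟨M, fun n hn => (hc n hn).trans he.symm⟩

theorem ip_eq {s t : D.Pre} {c : ℂ} (h : ∀ᶠ n in Filter.atTop, D.form (s.1 n) (t.1 n) = c) :
    D.ip s t = c := by
  obtain ⟨n, h1, h2⟩ := (h.and (D.ip_spec s t)).exists
  rw [← h1, ← h2]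

instance core : PreInnerProductSpace.Core ℂ D.Pre where
  inner s t := D.ip s t
  conj_inner_symm s t := by
    symm
    refine D.ip_eq ?_
    filter_upwards [D.ip_spec t s] with n hn
    rw [← hn, ← form_symm]
    rfl
  re_inner_nonneg s := by
    obtain ⟨n, hn⟩ := (D.ip_spec s s).exists
    rw [← hn]
    exact D.form_self_nonneg _
  add_left s t u := by
    refine D.ip_eq ?_
    filter_upwards [D.ip_spec s u, D.ip_spec t u] with n h1 h2
    rw [← h1, ← h2]
    exact D.form_add_left _ _ _
  smul_left s t c := by
    refine D.ip_eq ?_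
    filter_upwards [D.ip_spec s t] with n h1
    rw [← h1]
    exact D.form_smul_left _ _ _

instance : SeminormedAddCommGroup D.Pre := InnerProductSpace.Core.toSeminormedAddCommGroup (𝕜 := ℂ)
instance : InnerProductSpace ℂ D.Pre := InnerProductSpace.ofCore D.core

theorem inner_def (s t : D.Pre) : ⟪s, t⟫_ℂ = D.ip s t := rfl

/-- The Hilbert space of the representation. -/
abbrev Space : Type := UniformSpace.Completion D.Pre

theorem inner_ext {A B : D.Space →L[ℂ] D.Space}
    (hAB : ∀ s t : D.Pre, ⟪A s, (t : D.Space)⟫_ℂ = ⟪B s, (t : D.Space)⟫_ℂ) : A = B := by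
  ext x
  refine ext_inner_right ℂ fun y => ?_
  induction x, y using UniformSpace.Completion.induction_on₂ with
  | hp => apply isClosed_eq <;> fun_prop
  | ih s t => exact hAB s t

/-- The shift representing `U`. -/
def up : D.Pre →ₗ[ℂ] D.Pre where
  toFun s := ⟨fun n => s.1 (n + 1), (Filter.tendsto_add_atTop_nat 1).eventually s.2⟩
  map_add' _ _ := rfl
  map_smul' _ _ := rfl

/-- The shift representing `U⁻¹`. -/
def down : D.Pre →ₗ[ℂ] D.Pre where
  toFun s := ⟨fun n => Nat.casesOn n 0 s.1, by
    have h := s.2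
    change ∀ᶠ n in Filter.atTop, _
    rw [← Filter.map_add_atTop_eq_nat 1]
    exact Filter.eventually_map.2 h⟩
  map_add' s t := by
    refine Pre.ext D fun n => ?_
    cases n with
    | zero => exact (add_zero (0 : Linf)).symm
    | succ n => rfl
  map_smul' c s := by
    refine Pre.ext D fun n => ?_
    cases n with
    | zero => exact (smul_zero c).symm
    | succ n => rfl

/-- Multiplication, representing `π(f)`. -/
def mulOp (f : Linf) : D.Pre →ₗ[ℂ] D.Pre where
  toFun s := ⟨fun n => dil N n f * s.1 n, by
    filter_upwards [s.2] with n hn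
    rw [hn, dilate_mul, dilate_dil, mul_left_comm]⟩
  map_add' s t := Pre.ext D fun n => mul_add _ _ _
  map_smul' c s := Pre.ext D fun n => mul_smul_comm c (dil N n f) (s.1 n)

theorem ip_up_up (s t : D.Pre) : D.ip (D.up s) (D.up t) = D.ip s t :=
  D.ip_eq ((Filter.tendsto_add_atTop_nat 1).eventually (D.ip_spec s t))

theorem up_down (s : D.Pre) : D.up (D.down s) = s := Pre.ext D fun _ => rfl

theorem ip_down (s t : D.Pre) : D.ip (D.down s) t = D.ip s (D.up t) := by
  rw [← ip_up_up, up_down]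

theorem ip_mulOp (f : Linf) (s t : D.Pre) :
    D.ip (D.mulOp f s) t = D.ip s (D.mulOp (star f) t) := by
  refine D.ip_eq ?_
  filter_upwards [D.ip_spec s (D.mulOp (star f) t)] with n hn
  rw [← hn]
  exact D.form_mul _ _ _

theorem ip_mulOp_le (f : Linf) (C : ℝ) (hC : ∀ᵐ x ∂haar, ‖f.1 x‖ ≤ C) (s : D.Pre) :
    (D.ip (D.mulOp f s) (D.mulOp f s)).re ≤ C ^ 2 * (D.ip s s).re := by
  obtain ⟨n, h1, h2⟩ := ((D.ip_spec (D.mulOp f s) (D.mulOp f s)).and (D.ip_spec s s)).exists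
  rw [← h1, ← h2]
  exact D.form_mul_self_le _ _ C (dil_ae n (p := fun a _ => ‖a‖ ≤ C) (g := f) hC)

theorem norm_sq (s : D.Pre) : ‖s‖ ^ 2 = (D.ip s s).re := norm_sq_eq_re_inner (𝕜 := ℂ) s

theorem norm_up (s : D.Pre) : ‖D.up s‖ = ‖s‖ := by
  rw [← sq_eq_sq₀ (norm_nonneg _) (norm_nonneg _), norm_sq, norm_sq, ip_up_up]

/-- The operator `U`, as a bounded operator on the pre-Hilbert space. -/
def upL : D.Pre →L[ℂ] D.Pre := D.up.mkContinuous 1 fun s => by rw [norm_up, one_mul]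

/-- The operator `U⁻¹`, as a bounded operator on the pre-Hilbert space. -/
def downL : D.Pre →L[ℂ] D.Pre := D.down.mkContinuous 1 fun s => by
  rw [← norm_up, up_down, one_mul]

/-- The operator `π(f)`, as a bounded operator on the pre-Hilbert space. -/
def mulL (f : Linf) : D.Pre →L[ℂ] D.Pre :=
  (D.mulOp f).mkContinuous (exists_bound f).choose fun s => by
    obtain ⟨h0, h1⟩ := (exists_bound f).choose_spec
    rw [← sq_le_sq₀ (norm_nonneg _) (by positivity), mul_pow, norm_sq, norm_sq]
    exact D.ip_mulOp_le f _ h1 s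

theorem upL_apply (s : D.Pre) : D.upL.completion (s : D.Space) = (D.up s : D.Pre) :=
  D.upL.completion_apply_coe s

theorem downL_apply (s : D.Pre) : D.downL.completion (s : D.Space) = (D.down s : D.Pre) :=
  D.downL.completion_apply_coe s

theorem mulL_apply (f : Linf) (s : D.Pre) :
    (D.mulL f).completion (s : D.Space) = (D.mulOp f s : D.Pre) :=
  (D.mulL f).completion_apply_coe s

theorem inner_coe (s t : D.Pre) : ⟪(s : D.Space), (t : D.Space)⟫_ℂ = D.ip s t :=
  UniformSpace.Completion.inner_coe s t

theorem star_upL : star D.upL.completion = D.downL.completion := by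
  symm
  refine (ContinuousLinearMap.eq_adjoint_iff _ _).2 fun x y => ?_
  induction x, y using UniformSpace.Completion.induction_on₂ with
  | hp => apply isClosed_eq <;> fun_prop
  | ih s t => rw [downL_apply, upL_apply, inner_coe, inner_coe, ip_down]

/-- The unitary operator `U`. -/
def U : unitary (D.Space →L[ℂ] D.Space) :=
  ⟨D.upL.completion, by
    rw [Unitary.mem_iff, star_upL]
    constructor
    · refine D.inner_ext fun s t => ?_
      rw [mul_apply_eq_comp, upL_apply, downL_apply, inner_coe, ip_down, ip_up_up]
      exact (D.inner_coe s t).symm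
    · refine D.inner_ext fun s t => ?_
      rw [mul_apply_eq_comp, downL_apply, upL_apply, up_down]
      rfl⟩

/-- The representation `π`. -/
def π : Linf →⋆ₐ[ℂ] (D.Space →L[ℂ] D.Space) where
  toFun f := (D.mulL f).completion
  map_one' := by
    refine D.inner_ext fun s t => ?_
    rw [mulL_apply, show D.mulOp 1 s = s from Pre.ext D fun n => one_mul (s.1 n)]
    rfl
  map_zero' := by
    refine D.inner_ext fun s t => ?_
    rw [mulL_apply, show D.mulOp 0 s = 0 from Pre.ext D fun n => zero_mul (s.1 n)]
    simp
  map_mul' f g := by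
    refine D.inner_ext fun s t => ?_
    rw [mul_apply_eq_comp, mulL_apply, mulL_apply, mulL_apply,
      show D.mulOp (f * g) s = D.mulOp f (D.mulOp g s) from
        Pre.ext D fun n => mul_assoc (dil N n f) (dil N n g) (s.1 n)]
  map_add' f g := by
    refine D.inner_ext fun s t => ?_
    rw [add_apply, mulL_apply, mulL_apply, mulL_apply,
      show D.mulOp (f + g) s = D.mulOp f s + D.mulOp g s from
        Pre.ext D fun n => add_mul (dil N n f) (dil N n g) (s.1 n),
      UniformSpace.Completion.coe_add]
  commutes' c := by
    refine D.inner_ext fun s t => ?_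
    rw [mulL_apply, show D.mulOp (algebraMap ℂ Linf c) s = c • s from
        Pre.ext D fun n => (Algebra.smul_def c (s.1 n)).symm,
      Algebra.algebraMap_eq_smul_one, UniformSpace.Completion.coe_smul]
    rfl
  map_star' f := by
    refine (ContinuousLinearMap.eq_adjoint_iff _ _).2 fun x y => ?_
    induction x, y using UniformSpace.Completion.induction_on₂ with
    | hp => apply isClosed_eq <;> fun_prop
    | ih s t => rw [mulL_apply, mulL_apply, inner_coe, inner_coe, ip_mulOp, star_star]

theorem π_apply (f : Linf) (s : D.Pre) : D.π f (s : D.Space) = (D.mulOp f s : D.Pre) :=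
  D.mulL_apply f s

theorem U_apply (s : D.Pre) : (D.U : D.Space →L[ℂ] D.Space) s = (D.up s : D.Pre) :=
  D.upL_apply s

theorem U_inv_apply (s : D.Pre) :
    (↑D.U⁻¹ : D.Space →L[ℂ] D.Space) s = (D.down s : D.Pre) := by
  rw [← Unitary.star_eq_inv, Unitary.coe_star]
  change star D.upL.completion (s : D.Space) = _
  rw [star_upL, downL_apply]

/-- The products `m₀ (z) m₀ (z ^ N) ⋯ m₀ (z ^ (N ^ (n - 1)))`. -/
def prods : ℕ → Linf
  | 0 => 1
  | n + 1 => D.m₀ * dilate N (prods n)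

theorem prods_succ (n : ℕ) : D.prods (n + 1) = dil N n D.m₀ * D.prods n := by
  induction n with
  | zero => rw [dil_zero]; rfl
  | succ n ih =>
    conv_lhs => rw [prods, ih, dilate_mul, dilate_dil, mul_left_comm]
    rfl

/-- The vector `φ`. -/
def φ : D.Pre := ⟨D.prods, Filter.Eventually.of_forall fun _ => rfl⟩

theorem up_iterate (n : ℕ) (s : D.Pre) (k : ℕ) : ((D.up^[n]) s).1 k = s.1 (n + k) := by
  induction n generalizing s with
  | zero => simp
  | succ n ih =>
    rw [Function.iterate_succ_apply, ih]
    exact congrArg s.1 (by omega : n + k + 1 = n + 1 + k)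

theorem U_pow_apply (n : ℕ) (s : D.Pre) :
    (↑(D.U ^ n) : D.Space →L[ℂ] D.Space) s = ((D.up^[n]) s : D.Pre) := by
  induction n generalizing s with
  | zero => rfl
  | succ n ih =>
    rw [pow_succ, Function.iterate_succ_apply, ← ih, ← U_apply]
    rfl

theorem exists_eq (s : D.Pre) : ∃ (n : ℕ) (f : Linf),
    (s : D.Space) = (↑(D.U⁻¹ ^ n) : D.Space →L[ℂ] D.Space) (D.π f (D.φ : D.Space)) := by
  obtain ⟨n, hn⟩ := Filter.eventually_atTop.1 s.2
  refine ⟨n, s.1 n, ?_⟩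
  have h : (D.up^[n]) s = D.mulOp (s.1 n) D.φ := by
    refine Pre.ext D fun k => ?_
    rw [up_iterate]
    change _ = dil N k (s.1 n) * D.prods k
    induction k with
    | zero => rw [dil_zero]; exact (mul_one _).symm
    | succ k ih =>
      rw [← add_assoc, hn _ (Nat.le_add_right n k), ih, dilate_mul, dilate_dil, mul_left_comm]
      rfl
  rw [π_apply, ← h, ← U_pow_apply, ← mul_apply_eq_comp, ← Submonoid.coe_mul,
    inv_pow, inv_mul_cancel]
  rfl

/-- The representation just constructed is a cyclic representation associated to `h`. -/
def rep : CyclicRep N D.m₀ D.h D.Space where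
  U := D.U
  π := D.π
  φ := (D.φ : D.Space)
  π_congr f g hfg := by
    refine D.inner_ext fun s t => ?_
    rw [π_apply, π_apply, inner_coe, inner_coe]
    refine D.ip_eq ?_
    filter_upwards [D.ip_spec (D.mulOp g s) t] with n hn
    rw [← hn]
    refine integral_congr_ae ?_
    filter_upwards [dil_ae (N := N) n (p := fun a b => a = b) hfg] with x hx
    change star ((dil N n f).1 x * _) * _ * _ = star ((dil N n g).1 x * _) * _ * _
    rw [hx]
  cyclic := by
    rw [← Submodule.dense_iff_topologicalClosure_eq_top]
    refine (UniformSpace.Completion.denseRange_coe (α := D.Pre)).mono ?_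
    rintro _ ⟨s, rfl⟩
    exact Submodule.subset_span (D.exists_eq s)
  covariant f := by
    refine D.inner_ext fun s t => ?_
    rw [mul_apply_eq_comp, mul_apply_eq_comp, U_inv_apply, π_apply,
      U_apply, π_apply, show D.up (D.mulOp f (D.down s)) = D.mulOp (dilate N f) s from
        Pre.ext D fun n => by
          change dil N (n + 1) f * s.1 n = dil N n (dilate N f) * s.1 n
          rw [dil_dilate]]
  scaling := by
    rw [U_apply, π_apply, show D.up D.φ = D.mulOp D.m₀ D.φ from
      Pre.ext D fun n => D.prods_succ n]
  inner_eq f := by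
    rw [π_apply, inner_coe]
    refine D.ip_eq (Filter.Eventually.of_forall fun n => ?_)
    change D.form (D.prods n) (dil N n f * D.prods n) = _
    induction n with
    | zero =>
      rw [dil_zero, form]
      simp [prods]
    | succ n ih =>
      rw [← ih, ← D.form_step (D.prods n), dilate_mul, dilate_dil, mul_left_comm]
      rfl

end Datum

/-- Cyclic representations exist for every integrable `h ≥ 0` with `R_{m₀,m₀} h = h`. -/
theorem CyclicRep.nonempty (m₀ : Linf) (h : Torus → ℝ) (hi : Integrable h haar)
    (hpos : 0 ≤ᵐ[haar] h) (hR : transfer N m₀.1 h =ᵐ[haar] h) :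
    ∃ (H : Type) (_ : NormedAddCommGroup H) (_ : InnerProductSpace ℂ H) (_ : CompleteSpace H),
      Nonempty (CyclicRep N m₀ h H) :=
  ⟨_, inferInstance, inferInstance, inferInstance, ⟨(⟨m₀, h, hi, hpos, hR⟩ : Datum N).rep⟩⟩

end Existence

end WaveletDilation

end

open WaveletDilation

noncomputable section

namespace WaveletDilation

/-! ### Fibres of the power map and Fourier coefficients -/

section

/-! The isometry `W` is the adjoint of a bounded intertwiner `S : H₁ → H` with `S φ₁ = φ_h`. Since
`‖π_h(f) φ_h‖² = ∫ |f|² h ≤ ‖h‖_∞ ∫ |f|²`, the assignment `U₁⁻ⁿ π₁(f) φ₁ ↦ U_h⁻ⁿ π_h(f) φ_h` is well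
defined and bounded (`exists_norm_synthesis_le`, `comparison`). It carries the wavelet system of
`H₁` to that of `H`. If the former is an orthonormal basis `e_k`, Parseval and the frame identity
give `‖S* v‖² = ∑ |⟨v, S e_k⟩|² = ‖v‖²`. So `S*` is an isometry, `S* S` is the projection onto its
range, and the listed properties follow from the intertwining relations.

The substance is `isOrthonormalBasis_waveletSystem`. Orthonormality comes from the isometries `f ↦
m_i(z) f(z^N)` of `L²` having orthogonal ranges. For completeness, a vector `v` orthogonal to all
wavelets yields functions `u_n ∈ L²`, representing `U₁ⁿ v` on `π₁(L^∞) φ₁`, with `u_{n+1} = m₀(z)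
u_n(z^N)` for every integer `n`. A non-singular filter admits no such non-zero two-sided chain
(`NonSingular.ae_eq_zero`): by exactness of `z ↦ z^N`, the ratio `u_{n+1} / u_n` would be constant,
and this forces `|m₀| = 1`. -/

/-- The point of the circle that stands for `exp (2 π i j / N)`. -/
def root (N : ℕ) (j : Fin N) : Torus := (((j : ℕ) : ℝ) / (N : ℝ) : ℝ)

variable {N : ℕ}

theorem integral_sum_root {E : Type*} [NormedAddCommGroup E] [NormedSpace ℝ E] {f : Torus → E}
    (hf : Integrable f haar) :
    ∫ x, ∑ j, f (x + root N j) ∂haar = (N : ℝ) • ∫ x, f x ∂haar := by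
  rw [integral_finsetSum _ fun j _ => hf.comp_add_right _]
  simp only [integral_add_right_eq_self, Finset.sum_const, Finset.card_univ, Fintype.card_fin]
  rw [Nat.cast_smul_eq_nsmul]

/-- A unitary matrix has trivial kernel, and the factor `N^{-1/2}` does not affect the kernel. -/
theorem UnitaryFilters.eq_zero {m : Fin N → Torus → ℂ} (hm : UnitaryFilters N m) :
    ∀ᵐ x ∂haar, ∀ v : Fin N → ℂ, (∀ i, ∑ k, m i (x + root N k) * v k = 0) → v = 0 := by
  filter_upwards [hm] with x hx v hv
  set A := Matrix.of fun i j : Fin N =>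
        ((Real.sqrt N : ℝ) : ℂ)⁻¹ * m i (x + (((j : ℕ) : ℝ) / (N : ℝ) : ℝ)) with hA
  have h1 : A.mulVec v = 0 := by
    ext i
    simp only [hA, Matrix.mulVec, dotProduct, Matrix.of_apply, mul_assoc, Pi.zero_apply]
    rw [← Finset.mul_sum]
    exact mul_eq_zero_of_right _ (hv i)
  rw [← Matrix.one_mulVec v, ← Matrix.mem_unitaryGroup_iff'.1 hx, ← Matrix.mulVec_mulVec, h1,
    Matrix.mulVec_zero]

/-- Addition in `Fin N` wraps around modulo `N`, which is harmless because integers vanish in the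
circle. -/
theorem root_add_one [NeZero N] (k : Fin N) :
    root N (k + 1) = (((1 : ℝ) / (N : ℝ) : ℝ) : Torus) + root N k := by
  have hN : (N : ℝ) ≠ 0 := by exact_mod_cast NeZero.ne N
  have hmod : ∀ n : ℕ, ((((n % N : ℕ) : ℝ) / (N : ℝ) : ℝ) : Torus) = ((n : ℝ) / (N : ℝ) : ℝ) := by
    intro n
    have h : (n : ℝ) / N = ((n / N : ℕ) : ℝ) + ((n % N : ℕ) : ℝ) / N := by
      rw [div_eq_iff hN, add_mul, div_mul_cancel₀ _ hN]
      exact_mod_cast (Nat.div_add_mod' n N).symm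
    have h0 : ((((n / N : ℕ) : ℝ) : ℝ) : Torus) = 0 :=
      (AddCircle.coe_eq_zero_iff 1).2 ⟨(n / N : ℕ), by rw [zsmul_one]; exact Int.cast_natCast _⟩
    rw [h, AddCircle.coe_add, h0, zero_add]
  rw [root, root, ← AddCircle.coe_add, Fin.val_add, hmod, Fin.val_one', ← add_div, Nat.cast_add,
    add_div, AddCircle.coe_add, hmod, ← AddCircle.coe_add, ← add_div, Nat.cast_one, add_comm]

/-- Translation by `1 / N` permutes each fibre cyclically. This supplies the periodicity needed by
`fourierCoeff_eq_zero_of_periodic`. -/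
theorem sum_root_periodic [NeZero N] {M : Type*} [AddCommMonoid M] (f : Torus → M) (x : Torus) :
    ∑ k, f (x + (((1 : ℝ) / (N : ℝ) : ℝ) : Torus) + root N k) = ∑ k, f (x + root N k) := by
  rw [← Equiv.sum_comp (Equiv.addRight (1 : Fin N)) fun k => f (x + root N k)]
  simp only [Equiv.coe_addRight, root_add_one, add_assoc]

variable [N.AtLeastTwo]

theorem nsmul_root (j : Fin N) : N • root N j = 0 :=
  (AddCircle.nsmul_eq_zero_iff (NeZero.pos N)).2 ⟨j, j.2, by simp [root]⟩

theorem nsmul_add_root (x : Torus) (j : Fin N) : N • (x + root N j) = N • x := by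
  rw [smul_add, nsmul_root, add_zero]

theorem ae_add_right {p : Torus → Prop} (h : ∀ᵐ x ∂haar, p x) (a : Torus) :
    ∀ᵐ x ∂haar, p (x + a) :=
  (measurePreserving_add_right haar a).quasiMeasurePreserving.ae h

theorem ae_nsmul {p : Torus → Prop} (h : ∀ᵐ x ∂haar, p x) : ∀ᵐ x ∂haar, p (N • x) :=
  (measurePreserving_nsmul N).quasiMeasurePreserving.ae h

theorem integral_nsmul {E : Type*} [NormedAddCommGroup E] [NormedSpace ℝ E] {f : Torus → E}
    (hf : AEStronglyMeasurable f haar) : ∫ x, f (N • x) ∂haar = ∫ x, f x ∂haar := by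
  have hmp := measurePreserving_nsmul N
  rw [← integral_map (φ := fun x : Torus => N • x) hmp.measurable.aemeasurable
    (by rwa [hmp.map_eq]), hmp.map_eq]

theorem memLp_nsmul {E : Type*} [NormedAddCommGroup E] {p : ℝ≥0∞} {f : Torus → E}
    (hf : MemLp f p haar) : MemLp (fun x => f (N • x)) p haar :=
  hf.comp_measurePreserving (measurePreserving_nsmul N)

theorem memLp_add_right {E : Type*} [NormedAddCommGroup E] {p : ℝ≥0∞} {f : Torus → E}
    (hf : MemLp f p haar) (a : Torus) : MemLp (fun x => f (x + a)) p haar :=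
  hf.comp_measurePreserving (measurePreserving_add_right haar a)

theorem memLp_two_mul (f : Linf) {u : Torus → ℂ} (hu : MemLp u 2 haar) :
    MemLp (fun x => f.1 x * u x) 2 haar :=
  MemLp.mul' (p := ∞) (q := 2) (r := 2) hu f.2

theorem memLp_conj {p : ℝ≥0∞} {u : Torus → ℂ} (hu : MemLp u p haar) :
    MemLp (fun x => star (u x)) p haar := hu.star

theorem integrable_conj_mul {u v : Torus → ℂ} (hu : MemLp u 2 haar) (hv : MemLp v 2 haar) :
    Integrable (fun x => star (u x) * v x) haar :=
  (memLp_conj hu).integrable_mul hv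

theorem fourier_root_ne_one {n : ℤ} {M : ℕ} (hM : M ≠ 0) (hn : ¬ (M : ℤ) ∣ n) :
    (fourier n (((1 : ℝ) / (M : ℝ) : ℝ) : Torus) : ℂ) ≠ 1 := by
  rw [fourier_coe_apply, Ne, Complex.exp_eq_one_iff]
  rintro ⟨k, hk⟩
  apply hn
  have hM' : (M : ℂ) ≠ 0 := by exact_mod_cast hM
  have hpi : (2 * Real.pi * Complex.I : ℂ) ≠ 0 := Complex.two_pi_I_ne_zero
  refine ⟨k, ?_⟩
  push_cast at hk
  have h1 : (n : ℂ) / M = k := by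
    apply mul_left_cancel₀ hpi
    rw [mul_comm _ (k : ℂ), ← hk]
    field_simp
  rw [div_eq_iff hM'] at h1
  have h2 : (n : ℂ) = ((M * k : ℤ) : ℂ) := by push_cast; rw [h1, mul_comm]
  exact_mod_cast h2

/-- A Fourier coefficient of a function with period `1 / M` vanishes off the multiples of `M`. -/
theorem fourierCoeff_eq_zero_of_periodic {f : Torus → ℂ} {M : ℕ} (hM : M ≠ 0)
    (hf : ∀ᵐ x ∂haar, f (x + (((1 : ℝ) / (M : ℝ) : ℝ) : Torus)) = f x) {n : ℤ}
    (hn : ¬ (M : ℤ) ∣ n) : fourierCoeff f n = 0 := by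
  have hn' : ¬ (M : ℤ) ∣ -n := by rwa [dvd_neg]
  set a : Torus := (((1 : ℝ) / (M : ℝ) : ℝ) : Torus)
  -- Translating the integral by a period multiplies the coefficient by a root of unity different
  -- from `1`.
  have h : fourierCoeff f n = fourier (-n) a * fourierCoeff f n := by
    conv_lhs => rw [fourierCoeff, ← integral_add_right_eq_self _ a]
    rw [fourierCoeff, ← integral_const_mul]
    refine integral_congr_ae ?_
    filter_upwards [hf] with x hx
    rw [hx, smul_eq_mul, smul_eq_mul, fourier_apply, fourier_apply, fourier_apply, smul_add,
      AddCircle.toCircle_add, Circle.coe_mul]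
    ring
  have h2 : (1 - (fourier (-n) a : ℂ)) * fourierCoeff f n = 0 := by
    rw [sub_mul, one_mul, ← h, sub_self]
  exact (mul_eq_zero.1 h2).resolve_left (sub_ne_zero.2 (fourier_root_ne_one hM hn').symm)

theorem ae_eq_zero_of_fourierCoeff {f : Torus → ℂ} (hf : MemLp f 2 haar)
    (h : ∀ n, fourierCoeff f n = 0) : f =ᵐ[haar] 0 := by
  have h0 : hf.toLp f = 0 := by
    apply (fourierBasis (T := (1 : ℝ))).repr.injective
    ext n
    rw [fourierBasis_repr, map_zero, fourierCoeff_congr_ae hf.coeFn_toLp, h]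
    rfl
  filter_upwards [hf.coeFn_toLp, (h0 ▸ Lp.coeFn_zero ℂ 2 haar : hf.toLp f =ᵐ[haar] 0)] with x h1 h2
  rw [← h1, h2]

/-- Exactness of `z ↦ z ^ N`: a function that factors through all powers of it is constant. -/
theorem ae_const_of_tail {f : Torus → ℂ} (hf : MemLp f 2 haar)
    (h : ∀ k : ℕ, ∃ g : Torus → ℂ, ∀ᵐ x ∂haar, f x = g (N ^ k • x)) :
    ∃ c : ℂ, ∀ᵐ x ∂haar, f x = c := by
  have hc : ∀ n : ℤ, n ≠ 0 → fourierCoeff f n = 0 := by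
    intro n hn
    -- Once `N ^ k` exceeds `|n|` it cannot divide `n ≠ 0`, while `f` has period `1 / N ^ k`.
    obtain ⟨k, hk⟩ : ∃ k : ℕ, n.natAbs < N ^ k :=
      pow_unbounded_of_one_lt _ (Nat.AtLeastTwo.prop (n := N))
    obtain ⟨g, hg⟩ := h k
    have hNk : N ^ k ≠ 0 := pow_ne_zero _ (NeZero.ne N)
    refine fourierCoeff_eq_zero_of_periodic (M := N ^ k) hNk ?_ ?_
    · filter_upwards [hg, ae_add_right hg _] with x h1 h2
      have h0 : N ^ k • (((1 : ℝ) / ((N ^ k : ℕ) : ℝ) : ℝ) : Torus) = 0 :=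
        (AddCircle.nsmul_eq_zero_iff (Nat.pos_of_ne_zero hNk)).2 ⟨1, by
          have : n.natAbs ≠ 0 := Int.natAbs_ne_zero.2 hn
          omega, by simp⟩
      rw [h2, h1, smul_add, h0, add_zero]
    · intro hd
      have := Int.le_of_dvd (by positivity) ((dvd_abs _ _).2 hd)
      rw [Int.abs_eq_natAbs] at this
      exact absurd (by exact_mod_cast this) (not_le.2 hk)
  have hi : Integrable f haar := hf.integrable one_le_two
  refine ⟨fourierCoeff f 0, ?_⟩
  have hz := ae_eq_zero_of_fourierCoeff (hf.sub (memLp_const (fourierCoeff f 0))) fun n => by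
    have e : fourierCoeff (f - fun _ : Torus => fourierCoeff f 0) n =
        fourierCoeff f n - fourierCoeff (fun _ : Torus => fourierCoeff f 0) n := by
      simp only [fourierCoeff, Pi.sub_apply, smul_sub]
      exact integral_sub (hi.fourier_smul _) ((integrable_const _).fourier_smul _)
    rw [e]
    rcases eq_or_ne n 0 with rfl | hn
    · simp only [fourierCoeff, neg_zero, fourier_zero, one_smul]
      simp
    -- A constant has every period, so any `M` that does not divide `n` serves; `|n| + 1` is one.
    · rw [hc n hn, fourierCoeff_eq_zero_of_periodic (M := n.natAbs + 1) (by omega)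
        (Filter.Eventually.of_forall fun _ => rfl), sub_zero]
      intro hd
      have := Int.le_of_dvd (by positivity) ((dvd_abs _ _).2 hd)
      rw [Int.abs_eq_natAbs] at this
      omega
  filter_upwards [hz] with x hx
  exact sub_eq_zero.1 hx

/-! ### Orthogonality and completeness of the filter bank -/

section Filters

theorem UnitaryFilters.sum_conj_mul {m : Fin N → Torus → ℂ} (hm : UnitaryFilters N m) :
    ∀ᵐ x ∂haar, ∀ i j, ∑ k, star (m i (x + root N k)) * m j (x + root N k) =
      if i = j then (N : ℂ) else 0 := by
  filter_upwards [hm] with x hx i j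
  have hN : (N : ℂ) ≠ 0 := by exact_mod_cast NeZero.ne N
  have hs : ((Real.sqrt N : ℝ) : ℂ) * ((Real.sqrt N : ℝ) : ℂ) = N := by
    rw [← Complex.ofReal_mul, Real.mul_self_sqrt (by positivity)]
    simp
  have h1 := congrFun (congrFun (Matrix.mem_unitaryGroup_iff.1 hx) j) i
  rw [Matrix.mul_apply] at h1
  simp only [Matrix.of_apply, Matrix.star_apply, star_mul', star_inv₀, Complex.star_def,
    Complex.conj_ofReal, Matrix.one_apply] at h1
  have h2 : (N : ℂ)⁻¹ * ∑ k, star (m i (x + root N k)) * m j (x + root N k) =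
      if j = i then 1 else 0 := by
    rw [← h1, Finset.mul_sum, ← hs]
    refine Finset.sum_congr rfl fun k _ => ?_
    simp only [root, Complex.star_def]
    rw [mul_inv]
    ring
  rw [inv_mul_eq_iff_eq_mul₀ hN] at h2
  rw [h2]
  simp [eq_comm]

variable {m : Fin N → Linf}

theorem memLp_filter (f : Linf) {u : Torus → ℂ} (hu : MemLp u 2 haar) :
    MemLp (fun x => f.1 x * u (N • x)) 2 haar := memLp_two_mul f (memLp_nsmul hu)

/-- The isometries `f ↦ m_i (z) f (z ^ N)` have orthogonal ranges. -/
theorem UnitaryFilters.integral_conj_mul (hm : UnitaryFilters N fun i => (m i).1) (i j : Fin N)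
    {u v : Torus → ℂ} (hu : MemLp u 2 haar) (hv : MemLp v 2 haar) :
    ∫ x, star ((m i).1 x * u (N • x)) * ((m j).1 x * v (N • x)) ∂haar =
      if i = j then ∫ x, star (u x) * v x ∂haar else 0 := by
  have hN : (N : ℝ) ≠ 0 := by exact_mod_cast NeZero.ne N
  have h1 := integral_sum_root (N := N)
    (integrable_conj_mul (memLp_filter (N := N) (m i) hu) (memLp_filter (N := N) (m j) hv))
  refine smul_right_injective ℂ hN ?_
  dsimp only
  rw [← h1]
  -- The functions of `z ^ N` are constant on fibres, so summing over a fibre leaves the row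
  -- orthogonality of the filter matrix.
  have h2 : ∀ᵐ x ∂haar, ∑ k, star ((m i).1 (x + root N k) * u (N • (x + root N k))) *
      ((m j).1 (x + root N k) * v (N • (x + root N k))) =
      (if i = j then (N : ℂ) else 0) * (star (u (N • x)) * v (N • x)) := by
    filter_upwards [hm.sum_conj_mul] with x hx
    rw [← hx i j, Finset.sum_mul]
    refine Finset.sum_congr rfl fun k _ => ?_
    rw [nsmul_add_root, star_mul']
    ring
  rw [integral_congr_ae h2, integral_const_mul,
    integral_nsmul (N := N) (integrable_conj_mul hu hv).aestronglyMeasurable]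
  split_ifs <;> simp

/-- A square integrable function orthogonal to all `m_i (z) z ^ (N b)` vanishes. -/
theorem UnitaryFilters.ae_eq_zero (hm : UnitaryFilters N fun i => (m i).1) {d : Torus → ℂ}
    (hd : MemLp d 2 haar)
    (h : ∀ i (b : ℤ), ∫ x, star ((m i).1 x * fourier b (N • x)) * d x ∂haar = 0) :
    d =ᵐ[haar] 0 := by
  have hN : N ≠ 0 := NeZero.ne N
  let p : Fin N → Torus → ℂ := fun i x => star ((m i).1 x) * d x
  have hp : ∀ i, MemLp (p i) 2 haar := fun i => memLp_two_mul (star (m i)) hd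
  -- `G i` has period `1 / N`, so only frequencies `N b` can occur in it; those are the ones that
  -- the hypothesis kills.
  let G : Fin N → Torus → ℂ := fun i x => ∑ k, p i (x + root N k)
  have hG : ∀ i, MemLp (G i) 2 haar := fun i =>
    memLp_finsetSum _ fun k _ => memLp_add_right (hp i) _
  have hG0 : ∀ i, G i =ᵐ[haar] 0 := by
    intro i
    refine ae_eq_zero_of_fourierCoeff (hG i) fun n => ?_
    by_cases hn : (N : ℤ) ∣ n
    · obtain ⟨b, rfl⟩ := hn
      have hfN : ∀ x : Torus, (fourier (-((N : ℤ) * b)) x : ℂ) = star (fourier b (N • x) : ℂ) := by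
        intro x
        rw [fourier_neg, fourier_apply, fourier_apply, Complex.star_def, ← natCast_zsmul, smul_smul,
          mul_comm]
      have hi : Integrable (fun x => star ((m i).1 x * fourier b (N • x)) * d x) haar := by
        refine ((hp i).integrable one_le_two).fourier_smul (-((N : ℤ) * b)) |>.congr ?_
        refine Filter.Eventually.of_forall fun x => ?_
        simp only [p, smul_eq_mul, star_mul', hfN]
        ring
      have := integral_sum_root (N := N) hi
      rw [h i b, smul_zero] at this
      rw [fourierCoeff, ← this]
      congr 1
      ext x
      simp only [G, p, smul_eq_mul, hfN, Finset.mul_sum, nsmul_add_root, star_mul']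
      refine Finset.sum_congr rfl fun k _ => ?_
      ring
    · refine fourierCoeff_eq_zero_of_periodic hN (Filter.Eventually.of_forall fun x => ?_) hn
      exact sum_root_periodic (p i) x
  filter_upwards [hm.eq_zero, ae_all_iff.2 hG0] with x h1 h2
  -- The filters enter `G` conjugated, hence the conjugate of `d`; the entry at index `0` is the
  -- value at `x` itself.
  have h3 := congrFun (h1 (fun k => star (d (x + root N k))) fun i => by
    have := congrArg star (h2 i)
    simp only [G, p, star_sum, star_mul', star_star, Pi.zero_apply, star_zero] at this
    exact this) ⟨0, Nat.pos_of_ne_zero hN⟩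
  simpa [root] using h3

end Filters


end

/-! ### Exactness and the purity of non-singular filters -/

section

variable {N : ℕ} [N.AtLeastTwo]

theorem UnitaryFilters.sum_norm_sq {m : Fin N → Torus → ℂ} (hm : UnitaryFilters N m) (i : Fin N) :
    ∀ᵐ x ∂haar, ∑ k, ‖m i (x + root N k)‖ ^ 2 = N := by
  filter_upwards [hm.sum_conj_mul] with x hx
  have h := hx i i
  simp only [Complex.star_def, Complex.conj_mul', if_true] at h
  exact_mod_cast h

theorem integrable_norm_sq {f : Torus → ℂ} (hf : MemLp f 2 haar) :
    Integrable (fun x => ‖f x‖ ^ 2) haar :=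
  (memLp_two_iff_integrable_sq_norm hf.1).1 hf

theorem ae_eq_zero_of_integral_norm_sq {f : Torus → ℂ} (hf : MemLp f 2 haar)
    (h : ∫ x, ‖f x‖ ^ 2 ∂haar = 0) : ∀ᵐ x ∂haar, f x = 0 := by
  have := (integral_eq_zero_iff_of_nonneg (fun x => by positivity) (integrable_norm_sq hf)).1 h
  filter_upwards [this] with x hx
  simpa using hx

/-- An injective bounded measurable function on `ℂ`. -/
def squash (z : ℂ) : ℂ := ((1 + ‖z‖ : ℝ) : ℂ)⁻¹ * z

theorem norm_squash_le (z : ℂ) : ‖squash z‖ ≤ 1 := by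
  have : 0 < 1 + ‖z‖ := by positivity
  rw [squash, norm_mul, norm_inv, Complex.norm_real, Real.norm_of_nonneg this.le,
    inv_mul_le_iff₀ this]
  linarith

/-- The modulus `t / (1 + t)` determines `t`, after which the positive factor cancels. -/
theorem squash_injective : Function.Injective squash := by
  intro z w h
  have hz : 0 < 1 + ‖z‖ := by positivity
  have hw : 0 < 1 + ‖w‖ := by positivity
  have h1 := congrArg norm h
  simp only [squash, norm_mul, norm_inv, Complex.norm_real, Real.norm_of_nonneg hz.le,
    Real.norm_of_nonneg hw.le] at h1
  have h2 : ‖z‖ = ‖w‖ := by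
    field_simp at h1
    linarith
  rw [squash, squash, h2] at h
  exact mul_left_cancel₀ (inv_ne_zero (by exact_mod_cast hw.ne')) h

theorem measurable_squash : Measurable squash := by
  unfold squash
  fun_prop

/-- A measurable function that factors through all powers of `z ↦ z ^ N` is constant. -/
theorem ae_const_of_tail_of_aemeasurable {f : Torus → ℂ} (hf : AEMeasurable f haar)
    (h : ∀ k : ℕ, ∃ g : Torus → ℂ, ∀ᵐ x ∂haar, f x = g (N ^ k • x)) :
    ∃ c : ℂ, ∀ᵐ x ∂haar, f x = c := by
  have hs : MemLp (fun x => squash (f x)) 2 haar :=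
    MemLp.of_bound (measurable_squash.comp_aemeasurable hf).aestronglyMeasurable 1
      (Filter.Eventually.of_forall fun x => norm_squash_le _)
  obtain ⟨c, hc⟩ := ae_const_of_tail (N := N) hs fun k => by
    obtain ⟨g, hg⟩ := h k
    exact ⟨fun x => squash (g x), hg.mono fun x hx => by simp only [hx]⟩
  obtain ⟨x₀, hx₀⟩ := hc.exists
  refine ⟨f x₀, hc.mono fun x hx => squash_injective (hx.trans hx₀.symm)⟩

variable {m₀ : Linf}

/-- If `g (z ^ N)² = N⁻¹ ∑_j g (ρ ^ j z)²` for some `g ≥ 0`, then `g (z ^ N) = g (z)`. -/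
theorem nsmul_eq_self_of_sum_sq {g : Torus → ℝ} (h0 : ∀ x, 0 ≤ g x) (hg : Integrable g haar)
    (h : ∀ᵐ x ∂haar, ∑ k, g (x + root N k) ^ 2 = N * g (N • x) ^ 2) :
    ∀ᵐ x ∂haar, g (N • x) = g x := by
  have hN : (0 : ℝ) < N := by exact_mod_cast NeZero.pos N
  -- Cauchy–Schwarz on the fibre. Both sides have integral `N ∫ g`, so equality must hold almost
  -- everywhere.
  have hle : ∀ᵐ x ∂haar, ∑ k, g (x + root N k) ≤ N * g (N • x) := by
    filter_upwards [h] with x hx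
    have h1 := sq_sum_le_card_mul_sum_sq (s := Finset.univ) (f := fun k => g (x + root N k))
    rw [hx, Finset.card_univ, Fintype.card_fin] at h1
    refine (sq_le_sq₀ (Finset.sum_nonneg fun _ _ => h0 _) (mul_nonneg hN.le (h0 _))).1 ?_
    refine h1.trans (le_of_eq ?_)
    ring
  have hgN : Integrable (fun x => N * g (N • x)) haar :=
    ((measurePreserving_nsmul N).integrable_comp_of_integrable hg).const_mul _
  have hs : Integrable (fun x => ∑ k, g (x + root N k)) haar :=
    integrable_finsetSum _ fun k _ => hg.comp_add_right _
  have heq : ∀ᵐ x ∂haar, N * g (N • x) - ∑ k, g (x + root N k) = 0 := by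
    refine (integral_eq_zero_iff_of_nonneg_ae ?_ (hgN.sub hs)).1 ?_
    · filter_upwards [hle] with x hx
      exact sub_nonneg.2 hx
    · rw [integral_sub' hgN hs, integral_sum_root hg, integral_const_mul,
        integral_nsmul hg.aestronglyMeasurable, smul_eq_mul, sub_self]
  filter_upwards [h, heq] with x h1 h2
  -- With mean `g (N • x)` and mean square `g (N • x) ^ 2` over the fibre, the variance is zero.
  have h3 : ∑ k, (g (x + root N k) - g (N • x)) ^ 2 = 0 := by
    have : ∀ k, (g (x + root N k) - g (N • x)) ^ 2 =
        g (x + root N k) ^ 2 - 2 * g (N • x) * g (x + root N k) + g (N • x) ^ 2 := fun k => by ring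
    simp only [this, Finset.sum_add_distrib, Finset.sum_sub_distrib, ← Finset.mul_sum, h1,
      Finset.sum_const, Finset.card_univ, Fintype.card_fin, nsmul_eq_mul]
    rw [← sub_eq_zero.1 h2]
    ring
  have h4 := (Finset.sum_eq_zero_iff_of_nonneg fun _ _ => sq_nonneg _).1 h3
    ⟨0, NeZero.pos N⟩ (Finset.mem_univ _)
  have h5 : g x - g (N • x) = 0 := by simpa [root] using h4
  linarith

/-- The isometry `f ↦ m₀ (z) f (z ^ N)` of a non-singular filter is a pure isometry. -/
theorem NonSingular.ae_eq_zero (hns : NonSingular m₀.1)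
    (hm : ∀ᵐ x ∂haar, ∑ k, ‖m₀.1 (x + root N k)‖ ^ 2 = N) {f : ℤ → Torus → ℂ}
    (hf : ∀ n, MemLp (f n) 2 haar)
    (h : ∀ n, ∀ᵐ x ∂haar, f (n + 1) x = m₀.1 x * f n (N • x)) (n : ℤ) :
    ∀ᵐ x ∂haar, f n x = 0 := by
  have hN : (N : ℝ) ≠ 0 := by exact_mod_cast NeZero.ne N
  -- The factor `M` is the same for all `n` and almost nowhere zero. Hence zero sets and ratios of
  -- the `f n` do not see it.
  have hM : ∀ k : ℕ, ∃ M : Torus → ℂ, (∀ᵐ x ∂haar, M x ≠ 0) ∧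
      ∀ n, ∀ᵐ x ∂haar, f (n + k) x = M x * f n (N ^ k • x) := by
    intro k
    induction k with
    | zero => exact ⟨1, by simp, fun n => by simp⟩
    | succ k ih =>
      obtain ⟨M, hM0, hM⟩ := ih
      refine ⟨fun x => m₀.1 x * M (N • x), ?_, fun n => ?_⟩
      · filter_upwards [hns.1, ae_nsmul (N := N) hM0] with x h1 h2
        exact mul_ne_zero h1 h2
      · filter_upwards [h (n + k), ae_nsmul (N := N) (hM n)] with x h1 h2
        rw [Nat.cast_succ, ← add_assoc, h1, h2, smul_smul, ← pow_succ, mul_assoc]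
  -- Here the chain must be two-sided: `f n` is expressed through `f (n - k)` for every `k`.
  have hM' : ∀ k : ℕ, ∃ M : Torus → ℂ, (∀ᵐ x ∂haar, M x ≠ 0) ∧
      ∀ n, ∀ᵐ x ∂haar, f n x = M x * f (n - k) (N ^ k • x) := by
    intro k
    obtain ⟨M, hM0, hM1⟩ := hM k
    exact ⟨M, hM0, fun n => by simpa using hM1 (n - k)⟩
  by_contra hne
  -- The indicator of the zero set factors through all powers of the map, so it is constant.
  have hf0 : ∀ᵐ x ∂haar, f n x ≠ 0 := by
    obtain ⟨c, hc⟩ := ae_const_of_tail_of_aemeasurable (N := N)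
      (f := fun x => if f n x = 0 then (1 : ℂ) else 0) (by
        refine Measurable.comp_aemeasurable (g := fun z : ℂ => if z = 0 then (1 : ℂ) else 0) ?_
          (hf n).1.aemeasurable
        exact Measurable.ite (measurableSet_singleton 0) measurable_const measurable_const)
      fun k => by
        obtain ⟨M, hM0, hM1⟩ := hM' k
        refine ⟨fun x => if f (n - k) x = 0 then 1 else 0, ?_⟩
        filter_upwards [hM0, hM1 n] with x h1 h2
        simp [h2, h1]
    by_cases hc0 : c = 0
    · filter_upwards [hc] with x hx h0
      simp [h0, hc0] at hx
    · refine absurd ?_ hne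
      filter_upwards [hc] with x hx
      by_contra h0
      simp [h0] at hx
      exact hc0 hx.symm
  -- The common factor `M` cancels in the ratio, which is therefore a tail function too.
  obtain ⟨c, hc⟩ := ae_const_of_tail_of_aemeasurable (N := N)
    (f := fun x => f (n + 1) x / f n x) ((hf (n + 1)).1.aemeasurable.div (hf n).1.aemeasurable)
    fun k => by
      obtain ⟨M, hM0, hM1⟩ := hM' k
      refine ⟨fun x => f (n + 1 - k) x / f (n - k) x, ?_⟩
      filter_upwards [hM0, hM1 n, hM1 (n + 1)] with x h1 h2 h3
      rw [h2, h3, mul_div_mul_left _ _ h1]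
  have hcm : ∀ᵐ x ∂haar, ‖c‖ * ‖f n x‖ = ‖m₀.1 x‖ * ‖f n (N • x)‖ := by
    filter_upwards [hc, hf0, h n] with x h1 h2 h3
    rw [← norm_mul, ← norm_mul, ← h3, ← h1, div_mul_cancel₀ _ h2]
  have hsum : ∀ᵐ x ∂haar, ‖c‖ ^ 2 * ∑ k, ‖f n (x + root N k)‖ ^ 2 = N * ‖f n (N • x)‖ ^ 2 := by
    filter_upwards [hm, ae_all_iff.2 fun k => ae_add_right hcm (root N k)] with x h1 h2
    rw [← h1, Finset.mul_sum, Finset.sum_mul]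
    refine Finset.sum_congr rfl fun k _ => ?_
    rw [← mul_pow, h2, nsmul_add_root, mul_pow]
  have hint := integrable_norm_sq (hf n)
  have hpos : ∫ x, ‖f n x‖ ^ 2 ∂haar ≠ 0 := fun h0 =>
    hne (ae_eq_zero_of_integral_norm_sq (hf n) h0)
  -- Integrating `hsum` gives `‖c‖² N ∫ |f n|² = N ∫ |f n|²` with a non-zero integral.
  have hc1 : ‖c‖ ^ 2 = 1 := by
    have h1 := integral_congr_ae hsum
    rw [integral_const_mul, integral_const_mul, integral_sum_root hint,
      integral_nsmul (N := N) (f := fun x => ‖f n x‖ ^ 2) hint.aestronglyMeasurable, smul_eq_mul,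
      ← mul_assoc] at h1
    have h2 := mul_right_cancel₀ hpos h1
    exact mul_right_cancel₀ hN (by rw [h2, one_mul])
  have hc1' : ‖c‖ = 1 :=
    (pow_eq_one_iff_of_nonneg (norm_nonneg c) two_ne_zero).1 hc1
  simp only [hc1, one_mul] at hsum
  have hfin := nsmul_eq_self_of_sum_sq (fun x => norm_nonneg (f n x))
    ((hf n).integrable one_le_two).norm hsum
  refine hns.2 ?_
  filter_upwards [hcm, hfin, hf0] with x h1 h2 h3
  rw [h2, hc1'] at h1
  exact (mul_right_cancel₀ (norm_ne_zero_iff.2 h3) h1).symm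


end

section

/-! ### Unitary operators, frames and range projections -/

section Unitary

variable {H H₁ : Type*} [NormedAddCommGroup H] [InnerProductSpace ℂ H] [CompleteSpace H]
  [NormedAddCommGroup H₁] [InnerProductSpace ℂ H₁] [CompleteSpace H₁]

theorem unitary_mul_apply (u v : unitary (H →L[ℂ] H)) (x : H) :
    (↑(u * v) : H →L[ℂ] H) x = (u : H →L[ℂ] H) ((v : H →L[ℂ] H) x) := rfl

theorem unitary_apply_inv (u : unitary (H →L[ℂ] H)) (x : H) :
    (u : H →L[ℂ] H) ((↑u⁻¹ : H →L[ℂ] H) x) = x := by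
  rw [← unitary_mul_apply, mul_inv_cancel]; rfl

theorem unitary_inv_apply (u : unitary (H →L[ℂ] H)) (x : H) :
    (↑u⁻¹ : H →L[ℂ] H) ((u : H →L[ℂ] H) x) = x := by
  rw [← unitary_mul_apply, inv_mul_cancel]; rfl

theorem unitary_apply_inv_pow (u : unitary (H →L[ℂ] H)) (n : ℕ) (x : H) :
    (u : H →L[ℂ] H) ((↑(u⁻¹ ^ n) : H →L[ℂ] H) x) =
      (↑(u⁻¹ ^ n) : H →L[ℂ] H) ((u : H →L[ℂ] H) x) := by
  rw [← unitary_mul_apply, ← unitary_mul_apply, (((Commute.refl u).inv_right).pow_right n).eq]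

theorem unitary_inner (u : unitary (H →L[ℂ] H)) (x y : H) :
    ⟪(u : H →L[ℂ] H) x, (u : H →L[ℂ] H) y⟫_ℂ = ⟪x, y⟫_ℂ :=
  ContinuousLinearMap.inner_map_map_of_mem_unitary u.2 x y

theorem unitary_inner_left (u : unitary (H →L[ℂ] H)) (x y : H) :
    ⟪(u : H →L[ℂ] H) x, y⟫_ℂ = ⟪x, (↑u⁻¹ : H →L[ℂ] H) y⟫_ℂ := by
  rw [← unitary_inner u x, unitary_apply_inv]

theorem unitary_norm (u : unitary (H →L[ℂ] H)) (x : H) : ‖(u : H →L[ℂ] H) x‖ = ‖x‖ :=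
  ContinuousLinearMap.norm_map_of_mem_unitary u.2 x

theorem intertwines_zpow {S : H₁ →L[ℂ] H} {u₁ : unitary (H₁ →L[ℂ] H₁)} {u : unitary (H →L[ℂ] H)}
    (h : ∀ v, S ((u₁ : H₁ →L[ℂ] H₁) v) = (u : H →L[ℂ] H) (S v)) (n : ℤ) (v : H₁) :
    S ((↑(u₁ ^ n) : H₁ →L[ℂ] H₁) v) = (↑(u ^ n) : H →L[ℂ] H) (S v) := by
  induction n using Int.induction_on generalizing v with
  | zero => rfl
  | succ n ih => rw [zpow_add_one, zpow_add_one, unitary_mul_apply, unitary_mul_apply, ih, h]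
  | pred n ih =>
    rw [zpow_sub_one, zpow_sub_one, unitary_mul_apply, unitary_mul_apply, ih]
    congr 1
    rw [← unitary_inv_apply u (S _), ← h, unitary_apply_inv]

theorem IsOrthonormalBasis.hasSum_norm_sq {ι : Type*} {e : ι → H₁} (he : IsOrthonormalBasis e)
    (v : H₁) : HasSum (fun i => ‖⟪v, e i⟫_ℂ‖ ^ 2) (‖v‖ ^ 2) := by
  let b := HilbertBasis.mk he.1 he.2.ge
  have h := b.hasSum_inner_mul_inner v v
  have hb : ∀ i, b i = e i := fun i => congrFun (HilbertBasis.coe_mk he.1 he.2.ge) i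
  have h2 := Complex.hasSum_re h
  have h3 : (⟪v, v⟫_ℂ).re = ‖v‖ ^ 2 := (norm_sq_eq_re_inner (𝕜 := ℂ) v).symm
  rw [h3] at h2
  refine h2.congr_fun fun i => ?_
  rw [hb, ← inner_conj_symm (e i) v, Complex.mul_conj, Complex.ofReal_re, Complex.normSq_eq_norm_sq]

/-- If `S` maps an orthonormal basis to a normalized tight frame, its adjoint is isometric. -/
theorem norm_adjoint_apply_of_frame {ι : Type*} {e : ι → H₁} (he : IsOrthonormalBasis e)
    {S : H₁ →L[ℂ] H} (hS : IsNormalizedTightFrame fun i => S (e i)) (v : H) :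
    ‖S.adjoint v‖ = ‖v‖ := by
  rw [← sq_eq_sq₀ (norm_nonneg _) (norm_nonneg _)]
  refine (he.hasSum_norm_sq (S.adjoint v)).unique ?_
  simp only [ContinuousLinearMap.adjoint_inner_left]
  exact hS v

/-- Both `w` and `W (S w)` have inner product `⟪S w, v⟫` with `W v`, the first by adjointness and
the second because `W` is isometric. -/
theorem rangeProjection_apply {S : H₁ →L[ℂ] H} {W : H →ₗᵢ[ℂ] H₁} (hW : ∀ v, W v = S.adjoint v)
    (w : H₁) : rangeProjection W w = W (S w) := by
  have : CompleteSpace (LinearMap.range W.toLinearMap) :=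
    (W.isometry.isUniformInducing.isComplete_range).completeSpace_coe
  change (LinearMap.range W.toLinearMap).starProjection w = W (S w)
  refine Submodule.eq_starProjection_of_mem_of_inner_eq_zero
    (LinearMap.mem_range_self W.toLinearMap (S w)) ?_
  rintro _ ⟨v, rfl⟩
  change ⟪w - W (S w), W v⟫_ℂ = 0
  rw [inner_sub_left, W.inner_map_map, hW, ContinuousLinearMap.adjoint_inner_right, sub_self]

end Unitary

theorem coord_zpow_apply (b : ℤ) (x : Torus) :
    (↑(coord ^ b) : Linf).1 x = (fourier b x : ℂ) := by
  induction b using Int.induction_on with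
  | zero => rw [zpow_zero, fourier_zero]; rfl
  | succ n ih =>
    rw [zpow_add_one, fourier_add, ← ih]
    rfl
  | pred n ih =>
    rw [zpow_sub_one, sub_eq_add_neg, fourier_add, ← ih, fourier_neg (n := 1)]
    rfl

theorem integral_coord_zpow (b c : ℤ) :
    ∫ x, star ((↑(coord ^ b) : Linf).1 x) * (↑(coord ^ c) : Linf).1 x ∂haar =
      if b = c then 1 else 0 := by
  have h := congrFun (fourierCoeff_fourier (T := (1 : ℝ)) c) b
  rw [fourierCoeff] at h
  simp only [coord_zpow_apply, Complex.star_def, ← fourier_neg]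
  simp only [smul_eq_mul] at h
  rw [h, Pi.single_apply]

variable {N : ℕ} [N.AtLeastTwo]

/-- The operator `f ↦ m₀ (z) f (z ^ N)` on `L^∞`. -/
def subdivision (N : ℕ) [N.AtLeastTwo] (m₀ : Linf) : Linf →ₗ[ℂ] Linf where
  toFun f := m₀ * dilate N f
  map_add' f g := by rw [← mul_add]; rfl
  map_smul' c f := by rw [RingHom.id_apply, ← mul_smul_comm]; rfl

/-! ### Calculus in a cyclic representation and the comparison operator -/

namespace CyclicRep

variable {m₀ : Linf} {h : Torus → ℝ} {H : Type*}
  [NormedAddCommGroup H] [InnerProductSpace ℂ H] [CompleteSpace H] (r : CyclicRep N m₀ h H)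

theorem π_mul_apply (f g : Linf) (v : H) : r.π (f * g) v = r.π f (r.π g v) := by
  rw [map_mul]; rfl

theorem U_π (f : Linf) (v : H) :
    (r.U : H →L[ℂ] H) (r.π f v) = r.π (dilate N f) ((r.U : H →L[ℂ] H) v) := by
  rw [← r.covariant f]
  change _ = (r.U : H →L[ℂ] H) (r.π f ((↑r.U⁻¹ : H →L[ℂ] H) ((r.U : H →L[ℂ] H) v)))
  rw [unitary_inv_apply]

theorem U_π_φ (f : Linf) :
    (r.U : H →L[ℂ] H) (r.π f r.φ) = r.π (subdivision N m₀ f) r.φ := by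
  rw [U_π, r.scaling, ← π_mul_apply, mul_comm]
  rfl

theorem U_pow_π_φ (n : ℕ) (f : Linf) :
    (↑(r.U ^ n) : H →L[ℂ] H) (r.π f r.φ) = r.π ((subdivision N m₀ ^ n) f) r.φ := by
  induction n generalizing f with
  | zero => rfl
  | succ n ih =>
    rw [pow_succ, unitary_mul_apply, U_π_φ, ih, pow_succ, Module.End.mul_apply]

theorem π_U_inv_pow (n : ℕ) (f : Linf) (v : H) :
    r.π f ((↑(r.U⁻¹ ^ n) : H →L[ℂ] H) v) =
      (↑(r.U⁻¹ ^ n) : H →L[ℂ] H) (r.π ((dilate N)^[n] f) v) := by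
  induction n generalizing f v with
  | zero => rfl
  | succ n ih =>
    rw [pow_succ', unitary_mul_apply, unitary_mul_apply,
      ← unitary_inv_apply r.U (r.π f _), U_π, unitary_apply_inv, ih, Function.iterate_succ_apply]

theorem inner_π_φ (f g : Linf) :
    ⟪r.π f r.φ, r.π g r.φ⟫_ℂ = ∫ x, star (f.1 x) * g.1 x * (h x : ℂ) ∂haar := by
  rw [← ContinuousLinearMap.adjoint_inner_right]
  change ⟪r.φ, star (r.π f) (r.π g r.φ)⟫_ℂ = _
  rw [← map_star, ← π_mul_apply, r.inner_eq]
  rfl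

theorem norm_π_φ_sq (f : Linf) : ‖r.π f r.φ‖ ^ 2 = ∫ x, ‖f.1 x‖ ^ 2 * h x ∂haar := by
  have h1 := r.inner_π_φ f f
  rw [inner_self_eq_norm_sq_to_K] at h1
  apply Complex.ofReal_injective
  rw [← integral_complex_ofReal]
  refine (Eq.trans ?_ h1).trans ?_
  · push_cast; rfl
  · congr 1
    ext x
    push_cast
    rw [Complex.star_def, Complex.conj_mul']

/-- Scaling lets a vector at level `n` be rewritten at any deeper level, so finite sums can be
brought to one level. -/
theorem U_inv_pow_add (n j : ℕ) (f : Linf) :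
    (↑(r.U⁻¹ ^ (n + j)) : H →L[ℂ] H) (r.π ((subdivision N m₀ ^ j) f) r.φ) =
      (↑(r.U⁻¹ ^ n) : H →L[ℂ] H) (r.π f r.φ) := by
  rw [← U_pow_π_φ, ← unitary_mul_apply]
  congr 3
  rw [pow_add, mul_assoc, inv_pow r.U j, inv_mul_cancel, mul_one]

/-- The linear map that sends the `n`-th copy of `f` to `U⁻ⁿ π(f) φ`. -/
def synthesis : (ℕ →₀ Linf) →ₗ[ℂ] H :=
  Finsupp.lsum ℂ fun n =>
    { toFun := fun f => (↑(r.U⁻¹ ^ n) : H →L[ℂ] H) (r.π f r.φ)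
      map_add' := fun f g => by rw [map_add, add_apply, map_add]
      map_smul' := fun c f => by
        rw [map_smul, smul_apply, map_smul, RingHom.id_apply] }

theorem synthesis_single (n : ℕ) (f : Linf) :
    r.synthesis (Finsupp.single n f) = (↑(r.U⁻¹ ^ n) : H →L[ℂ] H) (r.π f r.φ) := by
  rw [synthesis, Finsupp.lsum_single]
  rfl

/-- The common level is the largest index in the support. Level and function depend on `a` and `m₀`
alone, so the formula can be compared across two representations. -/
theorem synthesis_eq (a : ℕ →₀ Linf) :
    r.synthesis a = (↑(r.U⁻¹ ^ a.support.sup id) : H →L[ℂ] H)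
      (r.π (a.sum fun n f => (subdivision N m₀ ^ (a.support.sup id - n)) f) r.φ) := by
  rw [Finsupp.sum, map_sum, sum_apply, map_sum, synthesis,
    Finsupp.lsum_apply, Finsupp.sum]
  refine Finset.sum_congr rfl fun n hn => ?_
  have hle : n ≤ a.support.sup id := Finset.le_sup (f := id) hn
  have := r.U_inv_pow_add n (a.support.sup id - n) (a n)
  rw [Nat.add_sub_cancel' hle] at this
  exact this.symm

theorem denseRange_synthesis : DenseRange r.synthesis := by
  have h1 := Submodule.dense_iff_topologicalClosure_eq_top.2 r.cyclic
  refine h1.mono ?_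
  change (_ : Set H) ⊆ (LinearMap.range r.synthesis : Set H)
  refine SetLike.coe_subset_coe.2 (Submodule.span_le.2 ?_)
  rintro _ ⟨n, f, rfl⟩
  exact ⟨_, r.synthesis_single n f⟩

theorem clm_ext {E : Type*} [NormedAddCommGroup E] [NormedSpace ℂ E] {A B : H →L[ℂ] E}
    (hAB : ∀ (n : ℕ) (f : Linf), A ((↑(r.U⁻¹ ^ n) : H →L[ℂ] H) (r.π f r.φ)) =
      B ((↑(r.U⁻¹ ^ n) : H →L[ℂ] H) (r.π f r.φ))) : A = B := by
  refine ContinuousLinearMap.ext_on (Submodule.dense_iff_topologicalClosure_eq_top.2 r.cyclic) ?_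
  rintro _ ⟨n, f, rfl⟩
  exact hAB n f

theorem T_zpow (b : ℤ) : (↑(r.T ^ b) : H →L[ℂ] H) = r.π ↑(coord ^ b) := by
  have hT : (↑r.T⁻¹ : H →L[ℂ] H) = r.π ↑(coord⁻¹) := by
    rw [← Unitary.star_eq_inv, Unitary.coe_star, ← Unitary.star_eq_inv, Unitary.coe_star, map_star]
    rfl
  induction b using Int.induction_on with
  | zero => exact (map_one r.π).symm
  | succ n ih =>
    rw [zpow_add_one, zpow_add_one, Submonoid.coe_mul, Submonoid.coe_mul, map_mul, ih]
    rfl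
  | pred n ih =>
    rw [zpow_sub_one, zpow_sub_one, Submonoid.coe_mul, Submonoid.coe_mul, map_mul, ih, hT]

/-- One application of `U` moves a wavelet into `π(L^∞) φ`, where inner products are integrals. -/
theorem U_T_zpow_ψ (b : ℤ) (g : Linf) :
    (r.U : H →L[ℂ] H) ((↑(r.T ^ b) : H →L[ℂ] H) (r.ψ g)) =
      r.π (g * dilate N ↑(coord ^ b)) r.φ := by
  rw [T_zpow, U_π, ψ, unitary_apply_inv, ← π_mul_apply, mul_comm]

section Comparison

variable {H₁ : Type*} [NormedAddCommGroup H₁] [InnerProductSpace ℂ H₁] [CompleteSpace H₁]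
  (r₁ : CyclicRep N m₀ (fun _ => 1) H₁)

/-- At a common level the squared norms are `∫ |F|² h` and `∫ |F|²` with the same `F`, so the square
root of the essential supremum of `h` is a valid constant. -/
theorem exists_norm_synthesis_le (hbdd : MemLp h ∞ haar) :
    ∃ C, ∀ a, ‖r.synthesis a‖ ≤ C * ‖r₁.synthesis a‖ := by
  set C := lpNorm h ∞ haar
  have hC0 : 0 ≤ C := lpNorm_nonneg
  have hC : ∀ᵐ x ∂haar, ‖h x‖ ≤ C := ae_le_lpNorm_exponent_top hbdd
  refine ⟨√C, fun a => ?_⟩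
  rw [synthesis_eq, synthesis_eq, unitary_norm, unitary_norm,
    ← sq_le_sq₀ (norm_nonneg _) (by positivity), mul_pow, Real.sq_sqrt hC0, norm_π_φ_sq,
    norm_π_φ_sq, ← integral_const_mul]
  generalize (a.sum fun n f => (subdivision N m₀ ^ (a.support.sup id - n)) f) = F
  have hF : Integrable (fun x => ‖F.1 x‖ ^ 2) haar := integrable_norm_sq (F.2.mono_exponent le_top)
  refine integral_mono_ae ?_ ((hF.mul_const 1).const_mul C) ?_
  · exact hF.mul_of_top_left hbdd
  · filter_upwards [hC] with x hx
    rw [mul_one, mul_comm]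
    exact mul_le_mul_of_nonneg_right ((le_abs_self _).trans hx) (by positivity)

/-- The bounded intertwiner that sends `φ₁` to `φ`. -/
def comparison : H₁ →L[ℂ] H :=
  -- The extension is meaningful only under a norm bound, which is why the properties below carry
  -- `hbdd`.
  LinearMap.extendOfNorm (𝕜 := ℂ) (𝕜₂ := ℂ) (E := ℕ →₀ Linf) r.synthesis r₁.synthesis

theorem comparison_apply (hbdd : MemLp h ∞ haar) (n : ℕ) (f : Linf) :
    r.comparison r₁ ((↑(r₁.U⁻¹ ^ n) : H₁ →L[ℂ] H₁) (r₁.π f r₁.φ)) =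
      (↑(r.U⁻¹ ^ n) : H →L[ℂ] H) (r.π f r.φ) := by
  rw [← synthesis_single, ← synthesis_single]
  have h1 := LinearMap.extendOfNorm_eq (𝕜 := ℂ) (𝕜₂ := ℂ) (E := ℕ →₀ Linf) (f := r.synthesis)
    (e := r₁.synthesis) r₁.denseRange_synthesis (r.exists_norm_synthesis_le r₁ hbdd)
  exact h1 _

theorem comparison_φ (hbdd : MemLp h ∞ haar) : r.comparison r₁ r₁.φ = r.φ := by
  simpa using r.comparison_apply r₁ hbdd 0 1

theorem comparison_ψ (hbdd : MemLp h ∞ haar) (g : Linf) :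
    r.comparison r₁ (r₁.ψ g) = r.ψ g := by
  simpa [ψ] using r.comparison_apply r₁ hbdd 1 g

theorem comparison_U (hbdd : MemLp h ∞ haar) (v : H₁) :
    r.comparison r₁ ((r₁.U : H₁ →L[ℂ] H₁) v) = (r.U : H →L[ℂ] H) (r.comparison r₁ v) := by
  refine DFunLike.congr_fun (r₁.clm_ext (A := (r.comparison r₁).comp (r₁.U : H₁ →L[ℂ] H₁))
    (B := (r.U : H →L[ℂ] H).comp (r.comparison r₁)) fun n f => ?_) v
  change r.comparison r₁ ((r₁.U : H₁ →L[ℂ] H₁) _) = (r.U : H →L[ℂ] H) (r.comparison r₁ _)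
  rw [unitary_apply_inv_pow, U_π_φ, comparison_apply _ _ hbdd, comparison_apply _ _ hbdd,
    unitary_apply_inv_pow, U_π_φ]

theorem comparison_π (hbdd : MemLp h ∞ haar) (g : Linf) (v : H₁) :
    r.comparison r₁ (r₁.π g v) = r.π g (r.comparison r₁ v) := by
  refine DFunLike.congr_fun (r₁.clm_ext (A := (r.comparison r₁).comp (r₁.π g))
    (B := (r.π g).comp (r.comparison r₁)) fun n f => ?_) v
  change r.comparison r₁ (r₁.π g _) = r.π g (r.comparison r₁ _)
  rw [π_U_inv_pow, ← π_mul_apply, comparison_apply _ _ hbdd, comparison_apply _ _ hbdd,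
    π_U_inv_pow, ← π_mul_apply]

theorem comparison_waveletSystem (hbdd : MemLp h ∞ haar) (m : Fin N → Linf)
    (k : ℤ × ℤ × {i : Fin N // i ≠ 0}) :
    r.comparison r₁ (r₁.waveletSystem m k) = r.waveletSystem m k := by
  rw [waveletSystem, waveletSystem, unitary_mul_apply, unitary_mul_apply,
    intertwines_zpow (r.comparison_U r₁ hbdd), T_zpow, T_zpow, comparison_π _ _ hbdd,
    comparison_ψ _ _ hbdd]

end Comparison

end CyclicRep


end

/-! ### The wavelet basis in the representation of the constant function -/

section

/-- The inclusion of `L^∞` into `L²`. -/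
def linfToL2 : Linf →ₗ[ℂ] Lp ℂ 2 haar where
  toFun f := MemLp.toLp f.1 (f.2.mono_exponent le_top)
  map_add' _ _ := rfl
  map_smul' _ _ := rfl

theorem linfToL2_coeFn (f : Linf) : linfToL2 f =ᵐ[haar] f.1 :=
  MemLp.coeFn_toLp (f.2.mono_exponent le_top)

theorem denseRange_linfToL2 : DenseRange linfToL2 := by
  refine (ContinuousMap.toLp_denseRange ℂ haar ℂ (p := 2) (by simp)).mono ?_
  rintro _ ⟨f, rfl⟩
  have hf : MemLp f ∞ haar :=
    memLp_top_of_bound f.continuous.aestronglyMeasurable ‖f‖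
      (Filter.Eventually.of_forall fun x => f.norm_coe_le_norm x)
  refine ⟨⟨f, hf⟩, Lp.ext ?_⟩
  exact (linfToL2_coeFn _).trans (ContinuousMap.coeFn_toLp haar f).symm

variable {N : ℕ} [N.AtLeastTwo]

namespace CyclicRep

variable {m₀ : Linf} {m : Fin N → Linf} {H : Type*}
  [NormedAddCommGroup H] [InnerProductSpace ℂ H] [CompleteSpace H]

/-- The map `f ↦ π(f) φ`. -/
def orbit {h : Torus → ℝ} (r : CyclicRep N m₀ h H) : Linf →ₗ[ℂ] H where
  toFun f := r.π f r.φ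
  map_add' f g := by rw [map_add, add_apply]
  map_smul' c f := by rw [map_smul, smul_apply, RingHom.id_apply]

theorem norm_orbit (r : CyclicRep N m₀ (fun _ => 1) H) (f : Linf) :
    ‖r.orbit f‖ = ‖linfToL2 f‖ := by
  rw [← sq_eq_sq₀ (norm_nonneg _) (norm_nonneg _)]
  change ‖r.π f r.φ‖ ^ 2 = _
  rw [norm_π_φ_sq, norm_sq_eq_re_inner (𝕜 := ℂ) (linfToL2 f), L2.inner_def]
  simp only [mul_one]
  rw [← Complex.ofReal_re (∫ x, ‖f.1 x‖ ^ 2 ∂haar), ← integral_complex_ofReal]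
  change _ = Complex.re _
  congr 1
  refine integral_congr_ae ?_
  filter_upwards [linfToL2_coeFn f] with x hx
  rw [hx, inner_self_eq_norm_sq_to_K]
  push_cast
  rfl

/-- Vectors of the space of `1` are represented by square integrable functions on `π(L^∞) φ`. -/
theorem exists_memLp_two (r : CyclicRep N m₀ (fun _ => 1) H) (w : H) :
    ∃ u : Torus → ℂ, MemLp u 2 haar ∧
      ∀ f : Linf, ⟪r.π f r.φ, w⟫_ℂ = ∫ x, star (f.1 x) * u x ∂haar := by
  -- For `h = 1` the orbit map preserves the `L²` norm and extends to `L²`; the function sought is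
  -- `J* w`.
  let J : Lp ℂ 2 haar →L[ℂ] H := LinearMap.extendOfNorm r.orbit linfToL2
  have hJ : ∀ f, J (linfToL2 f) = r.π f r.φ := fun f =>
    LinearMap.extendOfNorm_eq denseRange_linfToL2
      ⟨1, fun f => by rw [one_mul, norm_orbit]⟩ f
  refine ⟨J.adjoint w, Lp.memLp _, fun f => ?_⟩
  rw [← hJ, ← ContinuousLinearMap.adjoint_inner_right, L2.inner_def]
  refine integral_congr_ae ?_
  filter_upwards [linfToL2_coeFn f] with x hx
  rw [hx, RCLike.inner_apply, mul_comm]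
  rfl

variable (r : CyclicRep N (m 0) (fun _ => 1) H)

theorem inner_π_filter (hm : UnitaryFilters N fun i => (m i).1) (i j : Fin N) (f g : Linf) :
    ⟪r.π (m i * dilate N f) r.φ, r.π (m j * dilate N g) r.φ⟫_ℂ =
      if i = j then ∫ x, star (f.1 x) * g.1 x ∂haar else 0 := by
  rw [inner_π_φ, ← hm.integral_conj_mul i j (f.2.mono_exponent le_top) (g.2.mono_exponent le_top)]
  simp only [Complex.ofReal_one, mul_one]
  rfl

/-- After `U ^ (1 - a')` the vector with the larger exponent lies in the range of the `m 0` branch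
and the other in that of the `m i'` branch; these are orthogonal as `i' ≠ 0`. -/
theorem inner_wavelet_eq_zero_of_lt (hm : UnitaryFilters N fun i => (m i).1)
    {a a' : ℤ} (ha : a' < a) (b b' : ℤ) (i : Fin N) {i' : Fin N} (hi' : i' ≠ 0) :
    ⟪(↑(r.U ^ a * r.T ^ b) : H →L[ℂ] H) (r.ψ (m i)),
      (↑(r.U ^ a' * r.T ^ b') : H →L[ℂ] H) (r.ψ (m i'))⟫_ℂ = 0 := by
  obtain ⟨d, rfl⟩ : ∃ d : ℕ, a = a' + (1 + d) := ⟨(a - a' - 1).toNat, by omega⟩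
  have h1 : r.U ^ (a' + (1 + (d : ℤ))) * r.T ^ b = r.U ^ a' * (r.U ^ d * (r.U * r.T ^ b)) := by
    rw [zpow_add, add_comm 1 (d : ℤ), zpow_add_one, zpow_natCast]
    simp only [mul_assoc]
  rw [h1, unitary_mul_apply, unitary_mul_apply _ (r.T ^ b'), unitary_inner, ← unitary_inner r.U,
    U_T_zpow_ψ, unitary_mul_apply, unitary_mul_apply, U_T_zpow_ψ, U_pow_π_φ, U_π_φ]
  change ⟪r.π (m 0 * dilate N _) r.φ, _⟫_ℂ = 0
  rw [r.inner_π_filter hm, if_neg hi'.symm]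

theorem orthonormal_waveletSystem (hm : UnitaryFilters N fun i => (m i).1) :
    Orthonormal ℂ (r.waveletSystem m) := by
  rw [orthonormal_iff_ite]
  rintro ⟨a, b, i⟩ ⟨a', b', i'⟩
  change ⟪(↑(r.U ^ a * r.T ^ b) : H →L[ℂ] H) (r.ψ (m i)),
      (↑(r.U ^ a' * r.T ^ b') : H →L[ℂ] H) (r.ψ (m i'))⟫_ℂ = _
  rcases lt_trichotomy a a' with h | rfl | h
  · rw [← inner_conj_symm, r.inner_wavelet_eq_zero_of_lt hm h _ _ _ i.2, map_zero, if_neg]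
    simp [h.ne]
  · rw [unitary_mul_apply, unitary_mul_apply, unitary_inner, ← unitary_inner r.U, U_T_zpow_ψ,
      U_T_zpow_ψ, r.inner_π_filter hm, integral_coord_zpow]
    simp only [Prod.mk.injEq, true_and, Subtype.ext_iff]
    split_ifs <;> simp_all
  · rw [r.inner_wavelet_eq_zero_of_lt hm h _ _ _ i'.2, if_neg]
    simp [h.ne']

theorem isOrthonormalBasis_waveletSystem (hns : NonSingular (m 0).1)
    (hm : UnitaryFilters N fun i => (m i).1) : IsOrthonormalBasis (r.waveletSystem m) := by
  refine ⟨r.orthonormal_waveletSystem hm, ?_⟩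
  rw [Submodule.topologicalClosure_eq_top_iff, eq_bot_iff]
  intro v hv
  have hv' : ∀ (a b : ℤ) (i : Fin N), i ≠ 0 →
      ⟪(↑(r.U ^ a * r.T ^ b) : H →L[ℂ] H) (r.ψ (m i)), v⟫_ℂ = 0 := fun a b i hi =>
    hv _ (Submodule.subset_span ⟨(a, b, ⟨i, hi⟩), rfl⟩)
  choose u hu huv using fun n : ℤ => r.exists_memLp_two ((↑(r.U ^ n) : H →L[ℂ] H) v)
  have hstep : ∀ n, ∀ᵐ x ∂haar, u (n + 1) x = (m 0).1 x * u n (N • x) := by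
    intro n
    have h2 := memLp_filter (N := N) (m 0) (hu n)
    -- The difference is tested against `m_i(z) z^{N b}`. For `i = 0` both terms equal `⟪π(z^b) φ,
    -- U^n v⟫`. For `i ≠ 0` one vanishes since `v` is orthogonal to the wavelets, the other by
    -- orthogonality of the filters.
    have hd := hm.ae_eq_zero ((hu (n + 1)).sub h2) fun i b => by
      have hb : MemLp (↑(coord ^ b) : Linf).1 2 haar :=
        (↑(coord ^ b) : Linf).2.mono_exponent le_top
      have hi := memLp_filter (N := N) (m i) hb
      have e1 := huv (n + 1) (m i * dilate N ↑(coord ^ b))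
      have e2 := huv n ↑(coord ^ b)
      have e3 := hm.integral_conj_mul i 0 hb (hu n)
      have e4 : ∀ x, ((m i * dilate N ↑(coord ^ b) : Linf)).1 x =
        (m i).1 x * (↑(coord ^ b) : Linf).1 (N • x) := fun x => rfl
      simp only [e4] at e1
      simp only [← coord_zpow_apply, Pi.sub_apply, mul_sub]
      rw [integral_sub (integrable_conj_mul hi (hu (n + 1))) (integrable_conj_mul hi h2), e3, ← e1,
        ← e2, add_comm n 1, zpow_one_add, unitary_mul_apply]
      split_ifs with h0
      · subst h0
        have := r.U_π_φ ↑(coord ^ b)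
        rw [show (m 0 * dilate N ↑(coord ^ b) : Linf) = subdivision N (m 0) ↑(coord ^ b) from rfl,
          ← this, unitary_inner, sub_self]
      · rw [← U_T_zpow_ψ, unitary_inner, sub_zero, ← inner_conj_symm, unitary_inner_left,
          ← zpow_neg, inner_conj_symm, ← unitary_mul_apply, hv' _ _ _ h0]
    filter_upwards [hd] with x hx
    exact sub_eq_zero.1 hx
  have hz := hns.ae_eq_zero (N := N) (hm.sum_norm_sq 0) hu hstep
  have hdense : Dense (Submodule.span ℂ
      {v : H | ∃ (n : ℕ) (f : Linf), v = (↑(r.U⁻¹ ^ n) : H →L[ℂ] H) (r.π f r.φ)} : Set H) :=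
    Submodule.dense_iff_topologicalClosure_eq_top.2 r.cyclic
  refine (Submodule.mem_bot ℂ).2 (hdense.eq_zero_of_inner_right ℂ fun w hw => ?_)
  induction hw using Submodule.span_induction with
  | mem w hw =>
    obtain ⟨n, f, rfl⟩ := hw
    -- Moving `U⁻ⁿ` to the other side turns the inner product into an integral against `u n`, which
    -- is zero.
    rw [unitary_inner_left, inv_pow, inv_inv, ← zpow_natCast, huv]
    refine integral_eq_zero_of_ae ?_
    filter_upwards [hz n] with x hx
    rw [hx, mul_zero]
    rfl
  | zero => exact inner_zero_left _
  | add x y _ _ hx hy => rw [inner_add_left, hx, hy, add_zero]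
  | smul c x _ hx => rw [inner_smul_left, hx, mul_zero]

end CyclicRep


end

end WaveletDilation

end

/-! ### The dilation theorem -/

theorem theorem5p2 (N : ℕ) [N.AtLeastTwo]
    (m : Fin N → Linf) (hns : NonSingular (m 0).1)
    (hR1 : transfer N (m 0).1 (fun _ => 1) =ᵐ[haar] fun _ => 1)
    (hunit : UnitaryFilters N fun i => (m i).1)
    (h : Torus → ℝ) (hbdd : MemLp h ∞ haar) (hpos : 0 ≤ᵐ[haar] h)
    (hRh : transfer N (m 0).1 h =ᵐ[haar] h)
    {H : Type*} [NormedAddCommGroup H] [InnerProductSpace ℂ H] [CompleteSpace H]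
    (r : CyclicRep N (m 0) h H)
    (hframe : IsNormalizedTightFrame (r.waveletSystem m))
    {H₁ : Type*} [NormedAddCommGroup H₁] [InnerProductSpace ℂ H₁] [CompleteSpace H₁]
    (r₁ : CyclicRep N (m 0) (fun _ => 1) H₁) :
    ∃ W : H →ₗᵢ[ℂ] H₁,
      (∀ v, W ((r.U : H →L[ℂ] H) v) = (r₁.U : H₁ →L[ℂ] H₁) (W v)) ∧
      (∀ f v, W (r.π f v) = r₁.π f (W v)) ∧
      rangeProjection W * (r₁.U : H₁ →L[ℂ] H₁) = (r₁.U : H₁ →L[ℂ] H₁) * rangeProjection W ∧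
      (∀ f, rangeProjection W * r₁.π f = r₁.π f * rangeProjection W) ∧
      rangeProjection W r₁.φ = W r.φ ∧
      IsOrthonormalBasis (r₁.waveletSystem m) ∧
      (∀ i, i ≠ 0 → rangeProjection W (r₁.ψ (m i)) = W (r.ψ (m i))) := by
  have honb := r₁.isOrthonormalBasis_waveletSystem hns hunit
  set S := r.comparison r₁
  have hSU := r.comparison_U r₁ hbdd
  have hSπ := r.comparison_π r₁ hbdd
  have hSk : (fun k => S (r₁.waveletSystem m k)) = r.waveletSystem m :=
    funext fun k => r.comparison_waveletSystem r₁ hbdd m k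
  let W : H →ₗᵢ[ℂ] H₁ :=
    ⟨S.adjoint.toLinearMap, fun v => norm_adjoint_apply_of_frame honb (hSk ▸ hframe) v⟩
  have hW : ∀ v, W v = S.adjoint v := fun _ => rfl
  have hP : ∀ w, rangeProjection W w = W (S w) := rangeProjection_apply hW
  have hSU' : ∀ w, S ((↑r₁.U⁻¹ : H₁ →L[ℂ] H₁) w) = (↑r.U⁻¹ : H →L[ℂ] H) (S w) := fun w => by
    simpa using intertwines_zpow hSU (-1) w
  -- Taking adjoints turns `U` into `U⁻¹` and `π(f)` into `π(star f)`, and `S` intertwines these as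
  -- well.
  have hWU : ∀ v, W ((r.U : H →L[ℂ] H) v) = (r₁.U : H₁ →L[ℂ] H₁) (W v) := fun v =>
    ext_inner_right ℂ fun w => by
      rw [hW, hW, ContinuousLinearMap.adjoint_inner_left, unitary_inner_left, unitary_inner_left,
        ContinuousLinearMap.adjoint_inner_left, hSU']
  have hWπ : ∀ f v, W (r.π f v) = r₁.π f (W v) := fun f v =>
    ext_inner_right ℂ fun w => by
      rw [hW, hW, ContinuousLinearMap.adjoint_inner_left,
        ← ContinuousLinearMap.adjoint_inner_right, ← ContinuousLinearMap.adjoint_inner_right (r₁.π f),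
        ContinuousLinearMap.adjoint_inner_left, ← ContinuousLinearMap.star_eq_adjoint,
        ← ContinuousLinearMap.star_eq_adjoint, ← map_star, ← map_star, hSπ]
  refine ⟨W, hWU, hWπ, ?_, fun f => ?_, ?_, honb, fun i _ => ?_⟩
  · refine ContinuousLinearMap.ext fun w => ?_
    change rangeProjection W ((r₁.U : H₁ →L[ℂ] H₁) w) = (r₁.U : H₁ →L[ℂ] H₁) (rangeProjection W w)
    rw [hP, hP, hSU, hWU]
  · refine ContinuousLinearMap.ext fun w => ?_
    change rangeProjection W (r₁.π f w) = r₁.π f (rangeProjection W w)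
    rw [hP, hP, hSπ, hWπ]
  · rw [hP, r.comparison_φ r₁ hbdd]
  · rw [hP, r.comparison_ψ r₁ hbdd]
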